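/- **Setting.** Let $d\ge 1$. User $i\in\{1,\dots,n\}$ holds $(x_i,y_i)\in\mathbb R^d\times\mathbb R$. A sequentially interactive mechanism lets user $i$ draw a message $z_i$ from a probability distribution $Q_i(\cdot\mid (x_i,y_i),z_1,\dots,z_{i-1})$; it is $\varepsilon$-sequentially interactive LDP if $Q_i(S\mid v,z_{1:i-1})\le e^{\varepsilon}Q_i(S\mid v',z_{1:i-1})$ for all $i$, all $z_{1:i-1}$, all data $v,v'$ and all measurable $S$. **Randomizer.** For $\|x\|_2\le r$, $\mathcal R^r_\varepsilon(x)$ draws a sign $b$ with $P(b=1)=\frac12+\frac{\|x\|_2}{2r}$, sets $v=b\,x/\|x\|_2$ (an arbitrary fixed unit vector replaces $x/\|x\|_2$ if $x=0$, and $P(b=1)=\frac12$ if $r=0$), draws $u$ uniformly from $\{u\in\mathbb S^{d-1}:\langle u,v\rangle>0\}$ with probability $\frac{e^\varepsilon}{e^\varepsilon+1}$ and uniformly from $\{u\in\mathbb S^{d-1}:\langle u,v\rangle\le 0\}$ otherwise, and outputs $r\,\frac{e^\varepsilon+1}{e^\varepsilon-1}\,\frac{\sqrt\pi\,\Gamma((d+1)/2)}{\Gamma(d/2)}\,u$.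 **Algorithm (LDP iterative hard thresholding).** Parameters: $T,\varepsilon,\eta,\tau_1,\tau_2,k'$. Put $\theta_0=0$, $\tilde x_{ij}=\operatorname{sgn}(x_{ij})\min\{|x_{ij}|,\tau_1\}$, $\tilde y_i=\operatorname{sgn}(y_i)\min\{|y_i|,\tau_2\}$, $r=\sqrt d\,\tau_1(\sqrt{k'}\tau_1+\tau_2)$. Split the users into $T$ consecutive groups $S_1,\dots,S_T$ of $\lfloor n/T\rfloor$ users, the remaining users joining $S_T$. For $t=1,\dots,T$: every $i\in S_t$ sends $z_i=\mathcal R^r_\varepsilon(\nabla_i)$ with $\nabla_i=\tilde x_i(\langle\theta_{t-1},\tilde x_i\rangle-\tilde y_i)$; the server sets $\tilde\theta_t=\theta_{t-1}-\frac{\eta}{|S_t|}\sum_{i\in S_t}z_i$, obtains $\theta_t'$ from $\tilde\theta_t$ by keeping the $k'$ entries of largest magnitude (ties broken by index) and setting the others to $0$, and lets $\theta_t$ be the Euclidean projection of $\theta_t'$ onto the unit ball. The output is $\theta_T$. **Theorem.** (1) For all $n,d,T,k',\eta$, all $\varepsilon>0$ and all $\tau_1,\tau_2\ge0$, the algorithm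 is $\varepsilon$-sequentially interactive LDP; moreover $\|\nabla_i\|_2\le r$ always, so that the randomizer is only applied in its domain. (2) There are universal constants $a,\eta,b,c>0$ and $q\in\mathbb N$ such that for every $\sigma\ge 0$ and $\varepsilon_0>0$ there is $C>0$, depending only on $\sigma$ and $\varepsilon_0$, with the following property. Let $n\ge2$, $d\ge1$, $k\ge0$, $0<\varepsilon\le\varepsilon_0$, and let $(x_i,y_i)$, $i\le n$, be i.i.d. copies of $(x,y)$ with $y=\langle\theta^*,x\rangle+\zeta$, $\mathbb E[\zeta\mid x]=0$, $\|\theta^*\|_0\le k$, $\|\theta^*\|_1\le1$, where $x$ and $y$ are (zero-mean) sub-Gaussian with variance proxy $\sigma^2$, i.e. $\mathbb E e^{s\langle x,u\rangle}\le e^{\sigma^2s^2/2}$ and $\mathbb E e^{sy}\le e^{\sigma^2s^2/2}$ for all $s\in\mathbb R$ and all unit vectors $u$, and $x$ is isotropic, i.e. has covariance matrix $I_d$. Then, with $T=\lceil a\log n\rceil$, step size $\eta$, $k'=8k$ and $\tau_1=\tau_2=b\,\sigma\sqrt{\log n}$, the output satisfies $$\|\theta_T-\theta^*\|_2\le C\,\frac{k\sqrt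 d}{\sqrt n\,\varepsilon}\,\log^q(nd)$$ with probability at least $1-C d^{-c}$ over the data and the randomness of the algorithm. -/

import Mathlib

open MeasureTheory ProbabilityTheory
open scoped NNReal ENNReal

namespace SparseLDP

noncomputable section

/-- `ℝ^d` with the Euclidean norm. -/
abbrev E (d : ℕ) : Type := EuclideanSpace ℝ (Fin d)

/-! ### Sequentially interactive mechanisms and local differential privacy -/

/-- A sequentially interactive mechanism for `n` users with data in `X` and messages in `Z`:
user `i` draws its message from a probability distribution that depends measurably on its own
datum and on the messages of the users before it, and on nothing else. -/
structure SeqMechanism (n : ℕ) (X Z : Type*) [MeasurableSpace X] [MeasurableSpace Z] where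
  /-- The conditional distribution of the message of user `i`. -/
  Q : (i : Fin n) → Kernel (X × (Fin i → Z)) Z
  /-- Each `Q i` consists of probability measures. -/
  markov : ∀ i, IsMarkovKernel (Q i)

/-- `ε` sequentially interactive local differential privacy. -/
def SeqMechanism.IsLDP {n : ℕ} {X Z : Type*} [MeasurableSpace X] [MeasurableSpace Z]
    (M : SeqMechanism n X Z) (ε : ℝ) : Prop :=
  ∀ (i : Fin n) (z : Fin i → Z) (x x' : X) (S : Set Z), MeasurableSet S →
    M.Q i (x, z) S ≤ ENNReal.ofReal (Real.exp ε) * M.Q i (x', z) S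

/-- The conditional law of the first `m` messages, given the data of all users: the messages are
drawn one after the other, the message of user `m` from `Q m`. -/
def SeqMechanism.transcript {n : ℕ} {X Z : Type*} [MeasurableSpace X] [MeasurableSpace Z]
    (M : SeqMechanism n X Z) : (m : ℕ) → m ≤ n → Kernel (Fin n → X) (Fin m → Z)
  | 0, _ => Kernel.const _ (Measure.dirac Fin.elim0)
  | m + 1, h =>
      ((M.transcript m (Nat.le_of_succ_le h)) ⊗ₖ
        ((M.Q ⟨m, h⟩).comap
          (fun p : (Fin n → X) × (Fin m → Z) => (p.1 ⟨m, h⟩, p.2)) (by fun_prop))).map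
        (fun p : (Fin m → Z) × Z => (Fin.snoc p.1 p.2 : Fin (m + 1) → Z))

/-- The law of the whole transcript when the data of the `n` users are i.i.d. with law `P`. -/
def SeqMechanism.transcriptLaw {n : ℕ} {X Z : Type*} [MeasurableSpace X] [MeasurableSpace Z]
    (M : SeqMechanism n X Z) (P : Measure X) : Measure (Fin n → Z) :=
  (M.transcript n le_rfl) ∘ₘ (Measure.pi fun _ : Fin n => P)

/-! ### The randomizer -/

/-- The uniform distribution on the set `A` of unit vectors, as a measure on `ℝ^d`. -/
def uniSphere {d : ℕ} (A : Set (Metric.sphere (0 : E d) 1)) : Measure (E d) :=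
  (ProbabilityTheory.cond (volume : Measure (E d)).toSphere A).map Subtype.val

/-- The distribution of the unit vector `u`, given the direction `v`: with probability
`e^ε / (e^ε + 1)` it is uniform on the unit vectors with `⟪u, v⟫ > 0`, and otherwise uniform on
those with `⟪u, v⟫ ≤ 0`. -/
def hemisphere {d : ℕ} (ε : ℝ) (v : E d) : Measure (E d) :=
  ENNReal.ofReal (Real.exp ε / (Real.exp ε + 1)) • uniSphere {u | 0 < inner ℝ (u : E d) v} +
  ENNReal.ofReal (1 / (Real.exp ε + 1)) • uniSphere {u | inner ℝ (u : E d) v ≤ 0}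

/-- The unit vector `x / ‖x‖`; for `x = 0` a fixed unit vector (the choice is immaterial: the two
signs are then equally likely, and the randomizer is uniform on a sphere). -/
def direction {d : ℕ} [NeZero d] (x : E d) : E d :=
  if x = 0 then EuclideanSpace.single 0 1 else ‖x‖⁻¹ • x

/-- The probability `1/2 + ‖x‖ / (2r)` of the sign `+1`. It lies in `[0, 1]` for `‖x‖ ≤ r`, which is
the intended domain; it is clamped to `[0, 1]` outside. -/
def signProb {d : ℕ} (r : ℝ) (x : E d) : ℝ :=
  max 0 (min 1 (1 / 2 + ‖x‖ / (2 * r)))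

/-- The length of the output of the randomizer, of order `r √d` for bounded privacy parameter and
divided by `ε` for small `ε`. It is the factor that makes the randomizer unbiased, since the first
coordinate of a uniform unit vector has mean absolute value `Γ(d/2) / (√π Γ((d+1)/2))`. -/
def outputRadius (d : ℕ) (ε r : ℝ) : ℝ :=
  r * ((Real.exp ε + 1) / (Real.exp ε - 1)) *
    (Real.sqrt Real.pi * Real.Gamma (((d : ℝ) + 1) / 2) / Real.Gamma ((d : ℝ) / 2))

/-- The law of the randomizer on input `x`: choose a sign `b` with `P(b = 1) = signProb r x`,
draw a unit vector according to `hemisphere` with direction `b x / ‖x‖`, and scale it. -/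
def randomizerLaw {d : ℕ} [NeZero d] (ε r : ℝ) (x : E d) : Measure (E d) :=
  (ENNReal.ofReal (signProb r x) • hemisphere ε (direction x) +
    ENNReal.ofReal (1 - signProb r x) • hemisphere ε (-direction x)).map
    (fun u => outputRadius d ε r • u)

lemma measurable_uniSphere {d : ℕ} {B : Type*} [MeasurableSpace B]
    (A : B → Set (Metric.sphere (0 : E d) 1))
    (hA : MeasurableSet {p : B × Metric.sphere (0 : E d) 1 | p.2 ∈ A p.1}) :
    Measurable fun b => uniSphere (A b) := by
  refine Measure.measurable_of_measurable_coe _ fun S hS => ?_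
  have hAb : ∀ b, MeasurableSet (A b) := fun b => measurable_prodMk_left hA
  have hS' : MeasurableSet ((Subtype.val : Metric.sphere (0 : E d) 1 → E d) ⁻¹' S) :=
    measurable_subtype_coe hS
  have : ∀ b, uniSphere (A b) S = ((volume : Measure (E d)).toSphere (A b))⁻¹ *
      (volume : Measure (E d)).toSphere (A b ∩ Subtype.val ⁻¹' S) := fun b => by
    rw [uniSphere, Measure.map_apply measurable_subtype_coe hS, ProbabilityTheory.cond_apply (hAb b)]
  simp_rw [this]
  refine Measurable.mul (Measurable.inv ?_) ?_
  · exact measurable_measure_prodMk_left hA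
  · have : MeasurableSet ({p : B × Metric.sphere (0 : E d) 1 | p.2 ∈ A p.1} ∩
        Prod.snd ⁻¹' (Subtype.val ⁻¹' S)) := hA.inter (measurable_snd hS')
    exact measurable_measure_prodMk_left this

lemma measurable_hemisphere {d : ℕ} (ε : ℝ) : Measurable (hemisphere (d := d) ε) := by
  have hm : Measurable fun p : E d × Metric.sphere (0 : E d) 1 => inner ℝ (p.2 : E d) p.1 :=
    (measurable_subtype_coe.comp measurable_snd).inner measurable_fst
  have h1 := measurable_uniSphere
    (fun v : E d => {u : Metric.sphere (0 : E d) 1 | 0 < inner ℝ (u : E d) v})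
    (measurableSet_lt measurable_const hm)
  have h2 := measurable_uniSphere
    (fun v : E d => {u : Metric.sphere (0 : E d) 1 | inner ℝ (u : E d) v ≤ 0})
    (measurableSet_le hm measurable_const)
  refine Measure.measurable_of_measurable_coe _ fun S hS => ?_
  simp only [hemisphere, Measure.coe_add, Measure.coe_smul, Pi.add_apply, Pi.smul_apply,
    smul_eq_mul]
  exact (((Measure.measurable_coe hS).comp h1).const_mul _).add
    (((Measure.measurable_coe hS).comp h2).const_mul _)

lemma measurable_direction {d : ℕ} [NeZero d] : Measurable (direction (d := d)) :=
  Measurable.ite (measurableSet_singleton 0) measurable_const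
    (measurable_norm.inv.smul measurable_id)

lemma measurable_signProb {d : ℕ} (r : ℝ) : Measurable (signProb (d := d) r) := by
  unfold signProb; fun_prop

lemma measurable_randomizerLaw {d : ℕ} [NeZero d] (ε r : ℝ) :
    Measurable (randomizerLaw (d := d) ε r) := by
  refine (Measure.measurable_map _ (measurable_const_smul _)).comp ?_
  have h1 : Measurable fun x : E d => hemisphere ε (direction x) :=
    (measurable_hemisphere ε).comp measurable_direction
  have h2 : Measurable fun x : E d => hemisphere ε (-direction x) :=
    (measurable_hemisphere ε).comp measurable_direction.neg
  have h3 := (measurable_signProb (d := d) r)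
  refine Measure.measurable_of_measurable_coe _ fun S hS => ?_
  simp only [Measure.coe_add, Measure.coe_smul, Pi.add_apply, Pi.smul_apply, smul_eq_mul]
  exact (h3.ennreal_ofReal.mul ((Measure.measurable_coe hS).comp h1)).add
    ((h3.const_sub 1).ennreal_ofReal.mul ((Measure.measurable_coe hS).comp h2))

lemma direction_ne_zero {d : ℕ} [NeZero d] (x : E d) : direction x ≠ 0 := by
  unfold direction
  split_ifs with h
  · intro h0
    have := congrArg (fun v : E d => v 0) h0
    simp at this
  · simp [h]

lemma isProbabilityMeasure_hemisphere {d : ℕ} (ε : ℝ) {v : E d} (hv : v ≠ 0) :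
    IsProbabilityMeasure (hemisphere ε v) := by
  have hc : Continuous fun u : Metric.sphere (0 : E d) 1 => inner ℝ (u : E d) v := by fun_prop
  have hn : ‖v‖ ≠ 0 := norm_ne_zero_iff.2 hv
  have key : ∀ w : E d, w ≠ 0 → (‖w‖⁻¹ • w) ∈ Metric.sphere (0 : E d) 1 := fun w hw => by
    simp [norm_smul, hw]
  have hp : (volume : Measure (E d)).toSphere {u : Metric.sphere (0 : E d) 1 | 0 < inner ℝ (u : E d) v} ≠ 0 := by
    refine (IsOpen.measure_pos _ (isOpen_lt continuous_const hc) ⟨⟨_, key v hv⟩, ?_⟩).ne'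
    simp only [Set.mem_ofPred_eq, real_inner_smul_left, real_inner_self_eq_norm_sq]
    positivity
  have hq : (volume : Measure (E d)).toSphere {u : Metric.sphere (0 : E d) 1 | inner ℝ (u : E d) v ≤ 0} ≠ 0 := by
    have : (volume : Measure (E d)).toSphere {u : Metric.sphere (0 : E d) 1 | inner ℝ (u : E d) v < 0} ≠ 0 := by
      refine (IsOpen.measure_pos _ (isOpen_lt hc continuous_const)
        ⟨⟨_, key (-v) (neg_ne_zero.2 hv)⟩, ?_⟩).ne'
      simp only [Set.mem_ofPred_eq, real_inner_smul_left, inner_neg_left, norm_neg,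
        real_inner_self_eq_norm_sq]
      have : 0 < ‖v‖⁻¹ * ‖v‖ ^ 2 := by positivity
      linarith
    intro h0
    refine this (measure_mono_null ?_ h0)
    intro u hu
    simp only [Set.mem_ofPred_eq] at hu ⊢
    exact hu.le
  have e1 : uniSphere {u : Metric.sphere (0 : E d) 1 | 0 < inner ℝ (u : E d) v} Set.univ = 1 := by
    have := ProbabilityTheory.cond_isProbabilityMeasure hp
    rw [uniSphere, Measure.map_apply measurable_subtype_coe MeasurableSet.univ]
    simp
  have e2 : uniSphere {u : Metric.sphere (0 : E d) 1 | inner ℝ (u : E d) v ≤ 0} Set.univ = 1 := by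
    have := ProbabilityTheory.cond_isProbabilityMeasure hq
    rw [uniSphere, Measure.map_apply measurable_subtype_coe MeasurableSet.univ]
    simp
  refine ⟨?_⟩
  have hpos := Real.exp_pos ε
  simp only [hemisphere, Measure.coe_add, Measure.coe_smul, Pi.add_apply, Pi.smul_apply,
    smul_eq_mul, e1, e2, mul_one]
  rw [← ENNReal.ofReal_add (by positivity) (by positivity), ← add_div,
    div_self (by positivity), ENNReal.ofReal_one]

lemma isProbabilityMeasure_randomizerLaw {d : ℕ} [NeZero d] (ε r : ℝ) (x : E d) :
    IsProbabilityMeasure (randomizerLaw ε r x) := by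
  have h1 := isProbabilityMeasure_hemisphere ε (direction_ne_zero x)
  have h2 := isProbabilityMeasure_hemisphere ε (neg_ne_zero.2 (direction_ne_zero x))
  have a : 0 ≤ signProb r x := le_max_left _ _
  have b : signProb r x ≤ 1 := max_le zero_le_one (min_le_left _ _)
  refine ⟨?_⟩
  rw [randomizerLaw, Measure.map_apply (measurable_const_smul _) MeasurableSet.univ]
  simp only [Set.preimage_univ, Measure.coe_add, Measure.coe_smul, Pi.add_apply, Pi.smul_apply,
    smul_eq_mul, measure_univ, mul_one]
  rw [← ENNReal.ofReal_add a (by linarith)]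
  simp

/-- The randomizer as a Markov kernel. -/
def randomizer (d : ℕ) [NeZero d] (ε r : ℝ) : Kernel (E d) (E d) where
  toFun := randomizerLaw ε r
  measurable' := measurable_randomizerLaw ε r

instance (d : ℕ) [NeZero d] (ε r : ℝ) : IsMarkovKernel (randomizer d ε r) :=
  ⟨fun x => isProbabilityMeasure_randomizerLaw ε r x⟩

/-! ### LDP iterative hard thresholding -/

/-- The shrinkage `sgn(a) min(|a|, τ)`. -/
def shrink (τ a : ℝ) : ℝ := Real.sign a * min |a| τ

/-- Coordinatewise shrinkage. -/
def shrinkVec {d : ℕ} (τ : ℝ) (x : E d) : E d := WithLp.toLp 2 fun j => shrink τ (x j)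

open Classical in
/-- `Trunc(v, s)`: keep the `s` entries of largest magnitude (all of them if `d ≤ s`) and set the
others to zero; among entries of equal magnitude those of smaller index come first. -/
def trunc {d : ℕ} (s : ℕ) (v : E d) : E d := WithLp.toLp 2 fun j =>
  if (Finset.univ.filter fun i : Fin d => |v j| < |v i| ∨ (|v i| = |v j| ∧ i < j)).card < s
  then v j else 0

/-- The Euclidean projection onto the closed unit ball. -/
def projBall {d : ℕ} (v : E d) : E d := (max 1 ‖v‖)⁻¹ • v

/-- The parameters of the algorithm: number of iterations, privacy parameter, step size,
truncation levels, sparsity threshold. -/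
structure Params where
  T : ℕ
  ε : ℝ
  η : ℝ
  τ₁ : ℝ
  τ₂ : ℝ
  k' : ℕ

/-- The group of user `i`, where users and groups are numbered from `0`: groups `0, …, T - 1` are
consecutive blocks of `⌊n / T⌋` users, and the remaining users join the last group. -/
def group (n T i : ℕ) : ℕ := if i < (T - 1) * (n / T) then i / (n / T) else T - 1

/-- The number of users in group `t`. -/
def groupSize (n T t : ℕ) : ℕ := (Finset.univ.filter fun i : Fin n => group n T i = t).card

/-- The average `|S_t|⁻¹ ∑_{i ∈ S_t} z_i` of the messages of group `t` (all of which
belong to the history `z` whenever it is used). -/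
def groupMean {d m : ℕ} (n T t : ℕ) (z : Fin m → E d) : E d :=
  (groupSize n T t : ℝ)⁻¹ • ∑ i : Fin m, if group n T i = t then z i else 0

/-- The iterates of the server: start at `0`; then gradient step with the averaged messages of the
current group, hard thresholding, projection. -/
def iterate (A : Params) {d m : ℕ} (n : ℕ) (z : Fin m → E d) : ℕ → E d
  | 0 => 0
  | t + 1 => projBall (trunc A.k' (iterate A n z t - A.η • groupMean n A.T t z))

/-- The gradient `(⟪θ, x̃⟫ - ỹ) x̃` at the shrunken datum. -/
def clippedGradient (A : Params) {d : ℕ} (θ : E d) (p : E d × ℝ) : E d :=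
  (inner ℝ θ (shrinkVec A.τ₁ p.1) - shrink A.τ₂ p.2) • shrinkVec A.τ₁ p.1

/-- The radius `r = √d τ₁ (√k' τ₁ + τ₂)` handed to the randomizer. -/
def radius (A : Params) (d : ℕ) : ℝ :=
  Real.sqrt d * A.τ₁ * (Real.sqrt A.k' * A.τ₁ + A.τ₂)

/-- The vector that user `i` perturbs: the gradient at its own datum and at the current iterate,
which is a function of the messages of the earlier groups. -/
def userGradient (A : Params) {d : ℕ} (n i : ℕ) (p : (E d × ℝ) × (Fin i → E d)) : E d :=
  clippedGradient A (iterate A n p.2 (group n A.T i)) p.1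

lemma measurable_shrink (τ : ℝ) : Measurable (shrink τ) := by
  have : Measurable Real.sign := by
    unfold Real.sign
    exact Measurable.ite (measurableSet_lt measurable_id measurable_const) measurable_const
      (Measurable.ite (measurableSet_lt measurable_const measurable_id) measurable_const
        measurable_const)
  unfold shrink
  fun_prop

lemma measurable_shrinkVec {d : ℕ} (τ : ℝ) : Measurable (shrinkVec (d := d) τ) := by
  have := measurable_shrink τ
  unfold shrinkVec
  fun_prop

lemma measurable_trunc {d : ℕ} (s : ℕ) : Measurable (trunc (d := d) s) := by
  unfold trunc
  refine (WithLp.measurable_toLp 2 _).comp (measurable_pi_lambda _ fun j => ?_)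
  refine Measurable.ite ?_ (by fun_prop) measurable_const
  simp only [Finset.card_filter]
  refine measurableSet_lt (Finset.measurable_sum _ fun i _ => ?_) measurable_const
  refine Measurable.ite ?_ measurable_const measurable_const
  have hm : ∀ l : Fin d, Measurable fun v : E d => |v l| := fun l => by fun_prop
  exact (measurableSet_lt (hm j) (hm i)).union
    ((measurableSet_eq_fun (hm i) (hm j)).inter (MeasurableSet.const _))

lemma measurable_projBall {d : ℕ} : Measurable (projBall (d := d)) := by
  unfold projBall
  fun_prop

lemma measurable_groupMean {d m : ℕ} (n T t : ℕ) :
    Measurable (groupMean (d := d) (m := m) n T t) := by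
  unfold groupMean
  have h : Measurable fun z : Fin m → E d => ∑ i : Fin m, if group n T i = t then z i else 0 := by
    refine Finset.measurable_sum _ fun i _ => ?_
    split_ifs <;> fun_prop
  exact Measurable.const_smul h ((groupSize n T t : ℝ)⁻¹)

lemma measurable_iterate (A : Params) {d m : ℕ} (n t : ℕ) :
    Measurable fun z : Fin m → E d => iterate A n z t := by
  induction t with
  | zero => exact measurable_const
  | succ t ih =>
    exact measurable_projBall.comp ((measurable_trunc _).comp
      (ih.sub ((measurable_groupMean n A.T t).const_smul A.η)))

lemma measurable_userGradient (A : Params) {d : ℕ} (n i : ℕ) :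
    Measurable (userGradient A (d := d) n i) := by
  have h1 : Measurable fun p : (E d × ℝ) × (Fin i → E d) => iterate A n p.2 (group n A.T i) :=
    (measurable_iterate A n (group n A.T i)).comp measurable_snd
  have h2 : Measurable fun p : (E d × ℝ) × (Fin i → E d) => shrinkVec A.τ₁ p.1.1 :=
    (measurable_shrinkVec A.τ₁).comp (measurable_fst.comp measurable_fst)
  have h3 : Measurable fun p : (E d × ℝ) × (Fin i → E d) => shrink A.τ₂ p.1.2 :=
    (measurable_shrink A.τ₂).comp (measurable_snd.comp measurable_fst)
  exact ((h1.inner h2).sub h3).smul h2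

/-- LDP iterative hard thresholding as a sequentially interactive mechanism: user `i` sends the
randomized gradient. -/
def ldpIHT (A : Params) (n d : ℕ) [NeZero d] : SeqMechanism n (E d × ℝ) (E d) where
  Q i := (randomizer d A.ε (radius A d)).comap (userGradient A n i) (measurable_userGradient A n i)
  markov _ := inferInstance

/-- The law of the output `θ_T` for `n` i.i.d. users with law `P`. -/
def outputLaw (A : Params) (n d : ℕ) [NeZero d] (P : Measure (E d × ℝ)) : Measure (E d) :=
  ((ldpIHT A n d).transcriptLaw P).map fun z => iterate A n z A.T

/-! ### The statistical model -/

/-- `P` is the law of `(x, y)` in the sparse linear model `y = ⟪θ, x⟫ + ζ`, `E[ζ | x] = 0`, with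
`‖θ‖₀ ≤ k` and `‖θ‖₁ ≤ 1`, where `x` is a sub-Gaussian random vector and `y` a sub-Gaussian random
variable, both with variance proxy `σ²` (and hence with mean zero). -/
structure IsSparseModel {d : ℕ} (P : Measure (E d × ℝ)) (θ : E d) (k : ℕ) (σ : ℝ≥0) : Prop where
  sparse : (Finset.univ.filter fun j => θ j ≠ 0).card ≤ k
  l1_le : ∑ j, |θ j| ≤ 1
  subG_x : ∀ u : E d, ‖u‖ = 1 → HasSubgaussianMGF (fun p : E d × ℝ => inner ℝ p.1 u) (σ ^ 2) P
  subG_y : HasSubgaussianMGF (fun p : E d × ℝ => p.2) (σ ^ 2) P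
  noise : P[fun p : E d × ℝ => p.2 - inner ℝ θ p.1 |
    MeasurableSpace.comap (Prod.fst : E d × ℝ → E d) inferInstance] =ᵐ[P] 0

/-- The covariance matrix of `x`. -/
def covX {d : ℕ} (P : Measure (E d × ℝ)) : Matrix (Fin d) (Fin d) ℝ :=
  Matrix.of fun i j => cov[fun p : E d × ℝ => p.1 i, fun p : E d × ℝ => p.1 j; P]

end

end SparseLDP

namespace SparseLDP

noncomputable section

set_option linter.unusedSectionVars false

/-! ### Hard thresholding and projection -/

/-! Privacy: with respect to the uniform law on the sphere, the unit vector drawn by the randomizer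
has a density between `2 / (e^ε + 1)` and `2 e^ε / (e^ε + 1)`, whatever the input. The ratio of
these constants is `e^ε`, and the final scaling does not depend on the input (`randomizerLaw_le`).

Utility: by isotropy the population gradient at `θ` is `θ - θ*` (`IsSparseModel.integral_gradient`),
so one step of length `η = 1` from any point would land exactly on `θ*`. Hence only the last round
is analysed, and no contraction is tracked. About the iterate before it one needs only what holds
for every transcript: it is `8k`-sparse and lies in the unit ball (`iterate_sparse`). The earlier
rounds merely cost a factor of order `log n` in sample size.

The last step has two entrywise errors. Shrinkage at level `2σ√(log n)` biases the mean gradient by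
`O(√k σ² / n)` (`IsSparseModel.abs_meanGradient_sub_le`). The messages fluctuate: each is unbiased,
its entries are bounded by the output radius `R ≲ r√d / ε`, and their second moment is at most
`2R²/d` because the density above is at most `2`. A Bernstein bound gives an error of order `R
log(nd) log n / √(nd)` for all entries at once (`measure_groupMean_le`). It rests on an exponential
supermartingale along the messages: the datum of each user is independent of the earlier messages
(`lintegral_transcript_succ_pi`), and the iterate in use is frozen while the last group reports
(`iterate_snoc`).

Hard thresholding turns an entrywise error `δ` into the Euclidean error `2δ√(9k)`
(`norm_trunc_sub_le`), and projection does not increase it. As `r` carries a factor of order `√k`,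
the total is of order `k√d / (√n ε)` up to logarithms. The Bernstein parameter is admissible only
for `d ≤ n`; for `n ≤ d` the claimed bound exceeds the trivial bound `2`. -/

lemma norm_projBall_sub_le {d : ℕ} (v θ : E d) (hθ : ‖θ‖ ≤ 1) :
    ‖projBall v - θ‖ ≤ ‖v - θ‖ := by
  by_cases hv : ‖v‖ ≤ 1
  · simp [projBall, max_eq_left hv]
  · push Not at hv
    have h0 : (0 : ℝ) < ‖v‖ := by linarith
    refine le_of_sq_le_sq ?_ (norm_nonneg _)
    have e : projBall v = ‖v‖⁻¹ • v := by simp [projBall, max_eq_right hv.le]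
    rw [e, norm_sub_sq_real, norm_sub_sq_real, norm_smul, norm_inv, norm_norm,
      inv_mul_cancel₀ h0.ne', real_inner_smul_left]
    have hi : inner ℝ v θ ≤ ‖v‖ := (real_inner_le_norm v θ).trans (by nlinarith)
    have h1 : ‖v‖⁻¹ * inner ℝ v θ ≤ 1 := by
      rw [inv_mul_le_iff₀ h0]; linarith
    -- With `a = ⟪v, θ⟫ / ‖v‖ ≤ 1`, the difference of the squares is `(‖v‖ - 1)(‖v‖ + 1 - 2a)`,
    -- which is nonnegative.
    have h2 : inner ℝ v θ = ‖v‖ * (‖v‖⁻¹ * inner ℝ v θ) := by field_simp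
    nlinarith

lemma norm_projBall_le {d : ℕ} (v : E d) : ‖projBall v‖ ≤ 1 := by
  have := norm_projBall_sub_le v 0 (by simp)
  have h : (0 : ℝ) < max 1 ‖v‖ := lt_of_lt_of_le one_pos (le_max_left _ _)
  rw [projBall, norm_smul, norm_inv, Real.norm_of_nonneg h.le, inv_mul_le_iff₀ h]
  simp

lemma norm_le_one_of_l1 {d : ℕ} (θ : E d) (h : ∑ j, |θ j| ≤ 1) : ‖θ‖ ≤ 1 := by
  rw [EuclideanSpace.norm_eq]
  refine Real.sqrt_le_one.2 ?_
  have hj : ∀ j, |θ j| ≤ 1 := fun j =>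
    (Finset.single_le_sum (f := fun j => |θ j|) (fun _ _ => abs_nonneg _) (Finset.mem_univ j)).trans
      h
  refine le_trans (Finset.sum_le_sum fun j _ => ?_) h
  rw [Real.norm_eq_abs]
  nlinarith [abs_nonneg (θ j), hj j]

open Classical in
/-- The indices of the entries that precede entry `j` in the order used by `trunc`. -/
def ahead {d : ℕ} (v : E d) (j : Fin d) : Finset (Fin d) :=
  Finset.univ.filter fun i : Fin d => |v j| < |v i| ∨ (|v i| = |v j| ∧ i < j)

lemma trunc_apply {d : ℕ} (s : ℕ) (v : E d) (j : Fin d) :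
    trunc s v j = if (ahead v j).card < s then v j else 0 := rfl

/-- `ahead v j` is the strict initial segment before `j` in a total order, so all other kept entries
are ahead of the last kept one. -/
lemma card_kept_le {d : ℕ} (s : ℕ) (v : E d) :
    (Finset.univ.filter fun j => (ahead v j).card < s).card ≤ s := by
  classical
  set K := Finset.univ.filter fun j => (ahead v j).card < s with hK
  by_cases hne : K.Nonempty
  -- The last kept entry: smallest magnitude, and among ties the largest index, hence the order
  -- dual.
  · obtain ⟨j, hjK, hj⟩ := K.exists_minimalFor (fun j => toLex (|v j|, OrderDual.toDual j)) hne
    have hsub : K.erase j ⊆ ahead v j := by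
      intro i hi
      rw [Finset.mem_erase] at hi
      have hlt : toLex (|v j|, OrderDual.toDual j) < toLex (|v i|, OrderDual.toDual i) := by
        rcases lt_trichotomy (toLex (|v j|, OrderDual.toDual j))
          (toLex (|v i|, OrderDual.toDual i)) with h | h | h
        · exact h
        · simp at h
          exact absurd h.2.symm hi.1
        · exact absurd (hj hi.2 h.le) (not_le.2 h)
      rw [Prod.Lex.toLex_lt_toLex] at hlt
      simp only [ahead, Finset.mem_filter, Finset.mem_univ, true_and]
      rcases hlt with h | ⟨h1, h2⟩
      · exact Or.inl h
      · exact Or.inr ⟨h1.symm, h2⟩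
    have h1 := Finset.card_le_card hsub
    rw [Finset.card_erase_of_mem hjK] at h1
    have h2 : (ahead v j).card < s := by simpa [hK] using hjK
    omega
  · rw [Finset.not_nonempty_iff_eq_empty.1 hne]; simp

lemma card_support_trunc_le {d : ℕ} (s : ℕ) (v : E d) :
    (Finset.univ.filter fun j => trunc s v j ≠ 0).card ≤ s := by
  refine le_trans (Finset.card_le_card fun j hj => ?_) (card_kept_le s v)
  simp only [Finset.mem_filter, Finset.mem_univ, true_and, trunc_apply] at hj ⊢
  by_contra h
  simp [h] at hj

/-- If `v` is entrywise `δ`-close to a `k`-sparse vector, hard thresholding keeps it close in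
Euclidean norm. -/
lemma norm_trunc_sub_le {d : ℕ} {k s : ℕ} (hks : k ≤ s) (v θ : E d) {δ : ℝ} (hδ : 0 ≤ δ)
    (hθ : (Finset.univ.filter fun j => θ j ≠ 0).card ≤ k) (h : ∀ j, |v j - θ j| ≤ δ) :
    ‖trunc s v - θ‖ ≤ Real.sqrt (s + k) * (2 * δ) := by
  classical
  set K := Finset.univ.filter fun j => (ahead v j).card < s
  set B := Finset.univ.filter fun j => θ j ≠ 0 with hB
  have hpt : ∀ j, (trunc s v j - θ j) ^ 2 ≤ if j ∈ K ∪ B then (2 * δ) ^ 2 else 0 := by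
    intro j
    by_cases hj : j ∈ K
    · have hj' : (ahead v j).card < s := by simpa [K] using hj
      rw [if_pos (Finset.mem_union_left _ hj), trunc_apply, if_pos hj']
      refine sq_le_sq' ?_ ?_ <;> linarith [abs_le.1 (h j)]
    · have hj' : ¬ (ahead v j).card < s := by simpa [K] using hj
      rw [trunc_apply, if_neg hj']
      by_cases hjB : j ∈ B
      · rw [if_pos (Finset.mem_union_right _ hjB)]
        have hnj : j ∉ ahead v j := by simp [ahead]
        -- Pigeonhole: at least `s ≥ k` entries precede the dropped `j`, too many for the support of
        -- `θ` without `j`. An entry `i` off the support is pure error, so `|v j| ≤ |v i| ≤ δ` and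
        -- `|θ j| ≤ 2δ`.
        obtain ⟨i, hi, hiB⟩ : ∃ i ∈ ahead v j, i ∉ B := by
          by_contra! hcon
          have : ahead v j ⊆ B.erase j := fun i hi =>
            Finset.mem_erase.2 ⟨fun hij => hnj (hij ▸ hi), hcon i hi⟩
          have h1 := Finset.card_le_card this
          rw [Finset.card_erase_of_mem hjB] at h1
          have : 0 < B.card := Finset.card_pos.2 ⟨j, hjB⟩
          omega
        have hi0 : θ i = 0 := by simpa [hB] using hiB
        have hvi : |v i| ≤ δ := by simpa [hi0] using h i
        have hvj : |v j| ≤ |v i| := by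
          simp only [ahead, Finset.mem_filter, Finset.mem_univ, true_and] at hi
          rcases hi with h | h
          · exact h.le
          · exact h.1.ge
        have h1 := abs_le.1 (h j)
        have h2 := abs_le.1 (hvj.trans hvi)
        refine sq_le_sq' ?_ ?_ <;> linarith
      · have : θ j = 0 := by simpa [hB] using hjB
        rw [if_neg (by simp [hj, hjB]), this]; simp
  rw [EuclideanSpace.norm_eq]
  refine Real.sqrt_le_iff.2 ⟨by positivity, ?_⟩
  rw [mul_pow, Real.sq_sqrt (by positivity)]
  calc ∑ j, ‖(trunc s v - θ) j‖ ^ 2 = ∑ j, (trunc s v j - θ j) ^ 2 := by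
        simp
    _ ≤ ∑ j, if j ∈ K ∪ B then (2 * δ) ^ 2 else 0 := Finset.sum_le_sum fun j _ => hpt j
    _ = ((K ∪ B).card : ℝ) * (2 * δ) ^ 2 := by
        rw [← Finset.sum_filter, Finset.filter_mem_eq_inter, Finset.univ_inter, Finset.sum_const,
          nsmul_eq_mul]
    _ ≤ _ := by
        gcongr
        have h1 := Finset.card_union_le K B
        have h2 := card_kept_le s v
        exact_mod_cast h1.trans (add_le_add h2 hθ)

/-- Cauchy–Schwarz on the support. This is the source of `√k'` in `radius` and of `√(8k)` in the
bias. -/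
lemma sum_abs_le_of_sparse {d s : ℕ} (θ : E d)
    (hs : (Finset.univ.filter fun j => θ j ≠ 0).card ≤ s) (hθ : ‖θ‖ ≤ 1) :
    ∑ j, |θ j| ≤ Real.sqrt s := by
  refine Real.le_sqrt_of_sq_le ?_
  have h1 : ∑ j, |θ j| = ∑ j ∈ Finset.univ.filter (fun j => θ j ≠ 0), |θ j| := by
    rw [Finset.sum_filter]
    refine Finset.sum_congr rfl fun j _ => ?_
    split_ifs with h
    · rfl
    · simp at h; simp [h]
  have h2 : ∑ j ∈ Finset.univ.filter (fun j => θ j ≠ 0), |θ j| ^ 2 ≤ 1 := by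
    refine le_trans (Finset.sum_le_sum_of_subset_of_nonneg (Finset.filter_subset _ _)
      fun _ _ _ => by positivity) ?_
    have : ‖θ‖ ^ 2 ≤ 1 := by nlinarith [norm_nonneg θ]
    simpa [EuclideanSpace.norm_sq_eq] using this
  rw [h1]
  refine (sq_sum_le_card_mul_sum_sq).trans ?_
  have : ((Finset.univ.filter fun j => θ j ≠ 0).card : ℝ) ≤ s := by exact_mod_cast hs
  have h0 : 0 ≤ ∑ j ∈ Finset.univ.filter (fun j => θ j ≠ 0), |θ j| ^ 2 := by positivity
  nlinarith

/-- Thresholding bounds the support, and the projection only rescales. The invariant holds for every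
transcript, with no probability involved. -/
lemma iterate_sparse (A : Params) {d m : ℕ} (n : ℕ) (z : Fin m → E d) (t : ℕ) :
    (Finset.univ.filter fun j => iterate A n z t j ≠ 0).card ≤ A.k' ∧ ‖iterate A n z t‖ ≤ 1 := by
  cases t with
  | zero => simp [iterate]
  | succ t =>
    refine ⟨le_trans (Finset.card_le_card fun j hj => ?_)
      (card_support_trunc_le A.k' (iterate A n z t - A.η • groupMean n A.T t z)),
      norm_projBall_le _⟩
    simp only [Finset.mem_filter, Finset.mem_univ, true_and, iterate, projBall] at hj ⊢
    intro h
    simp [h] at hj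

lemma abs_shrink_le {τ : ℝ} (hτ : 0 ≤ τ) (a : ℝ) : |shrink τ a| ≤ τ := by
  rw [shrink, abs_mul, abs_of_nonneg (le_min (abs_nonneg a) hτ)]
  rcases lt_trichotomy a 0 with h | h | h
  · simp [Real.sign_of_neg h]
  · simp [h, hτ]
  · simp [Real.sign_of_pos h]

lemma norm_shrinkVec_le {d : ℕ} {τ : ℝ} (hτ : 0 ≤ τ) (x : E d) :
    ‖shrinkVec τ x‖ ≤ Real.sqrt d * τ := by
  rw [EuclideanSpace.norm_eq]
  refine Real.sqrt_le_iff.2 ⟨by positivity, ?_⟩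
  rw [mul_pow, Real.sq_sqrt (by positivity)]
  calc ∑ j, ‖shrinkVec τ x j‖ ^ 2 ≤ ∑ _j : Fin d, τ ^ 2 := by
        refine Finset.sum_le_sum fun j _ => ?_
        have := abs_shrink_le hτ (x j)
        exact pow_le_pow_left₀ (norm_nonneg _) this 2
    _ = _ := by simp

/-- The clipped gradient at a sparse vector of the unit ball lies in the domain of the
randomizer. -/
lemma norm_clippedGradient_le (A : Params) {d : ℕ} (h1 : 0 ≤ A.τ₁) (h2 : 0 ≤ A.τ₂) (θ : E d)
    (hs : (Finset.univ.filter fun j => θ j ≠ 0).card ≤ A.k') (hθ : ‖θ‖ ≤ 1) (p : E d × ℝ) :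
    ‖clippedGradient A θ p‖ ≤ radius A d := by
  have hi : |inner ℝ θ (shrinkVec A.τ₁ p.1)| ≤ Real.sqrt A.k' * A.τ₁ := by
    rw [PiLp.inner_apply]
    refine (Finset.abs_sum_le_sum_abs _ _).trans ?_
    refine le_trans (Finset.sum_le_sum (g := fun j => |θ j| * A.τ₁) fun j _ => ?_) ?_
    · have := abs_shrink_le h1 (p.1 j)
      simp only [RCLike.inner_apply, conj_trivial, abs_mul]
      rw [mul_comm]
      exact mul_le_mul_of_nonneg_left this (abs_nonneg _)
    · rw [← Finset.sum_mul]
      exact mul_le_mul_of_nonneg_right (sum_abs_le_of_sparse θ hs hθ) h1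
  rw [clippedGradient, norm_smul, radius, Real.norm_eq_abs]
  have h3 := abs_sub (inner ℝ θ (shrinkVec A.τ₁ p.1)) (shrink A.τ₂ p.2)
  have h4 := abs_shrink_le h2 p.2
  calc _ ≤ (Real.sqrt A.k' * A.τ₁ + A.τ₂) * (Real.sqrt d * A.τ₁) := by
        refine mul_le_mul (by linarith) (norm_shrinkVec_le h1 p.1) (norm_nonneg _) (by positivity)
    _ = _ := by ring

lemma norm_userGradient_le (A : Params) {d : ℕ} (h1 : 0 ≤ A.τ₁) (h2 : 0 ≤ A.τ₂) (n i : ℕ)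
    (p : (E d × ℝ) × (Fin i → E d)) : ‖userGradient A n i p‖ ≤ radius A d :=
  have h := iterate_sparse A n p.2 (group n A.T i)
  norm_clippedGradient_le A h1 h2 _ h.1 h.2 _

/-! ### The groups of users -/

lemma group_eq_last_iff {n T i : ℕ} :
    group n T i = T - 1 ↔ (T - 1) * (n / T) ≤ i := by
  unfold group
  split_ifs with h
  · refine iff_of_false (fun h' => ?_) (by omega)
    have := Nat.div_lt_of_lt_mul (by rwa [mul_comm] at h)
    omega
  · simp; omega

/-- The last group absorbs the remainder, so rounding works in its favour: `n - (T - 1)⌊n/T⌋ ≥ n/T`.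
-/
lemma le_groupSize_last {n T : ℕ} (hT : 1 ≤ T) :
    (n : ℝ) / T ≤ groupSize n T (T - 1) := by
  have h1 : n ≤ groupSize n T (T - 1) + (T - 1) * (n / T) := by
    have h2 := Finset.card_filter_add_card_filter_not (s := (Finset.univ : Finset (Fin n)))
      (fun i => group n T i = T - 1)
    have h3 : (Finset.univ.filter fun i : Fin n => ¬ group n T i = T - 1).card ≤
        (T - 1) * (n / T) := by
      rw [← Finset.card_range ((T - 1) * (n / T))]
      refine Finset.card_le_card_of_injOn (fun i => (i : ℕ)) (fun i hi => ?_)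
        fun i _ j _ h => Fin.ext h
      simpa [group_eq_last_iff] using hi
    rw [Finset.card_univ, Fintype.card_fin] at h2
    rw [groupSize]
    omega
  have hT' : (1 : ℝ) ≤ T := by exact_mod_cast hT
  have h2 : ((T - 1 : ℕ) : ℝ) = T - 1 := by push_cast [hT]; ring
  have h3 : (n : ℝ) ≤ groupSize n T (T - 1) + (T - 1) * ((n / T : ℕ) : ℝ) := by
    rw [← h2]; exact_mod_cast h1
  have h4 : ((n / T : ℕ) : ℝ) ≤ n / T := Nat.cast_div_le
  have h5 : (T - 1 : ℝ) * ((n / T : ℕ) : ℝ) ≤ (T - 1) * (n / T) :=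
    mul_le_mul_of_nonneg_left h4 (by linarith)
  have h6 : (T - 1 : ℝ) * (n / T) = n - n / T := by field_simp
  linarith

/-- Iterate `t` uses only groups `0, …, t - 1`, so a message from group `t` or later cannot change
it. -/
lemma iterate_snoc (A : Params) {d m : ℕ} (n t : ℕ) (z : Fin m → E d) (w : E d)
    (ht : t ≤ group n A.T m) :
    iterate A n (Fin.snoc z w : Fin (m + 1) → E d) t = iterate A n z t := by
  induction t with
  | zero => rfl
  | succ t ih =>
    have h : groupMean n A.T t (Fin.snoc z w : Fin (m + 1) → E d) = groupMean n A.T t z := by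
      have : group n A.T m ≠ t := by omega
      simp [groupMean, Fin.sum_univ_castSucc, this]
    rw [iterate, iterate, ih (by omega), h]

/-! ### The uniform distribution on the unit sphere -/

/-- The uniform distribution on the unit sphere of `ℝ^d`. -/
def sphereUnif (d : ℕ) : Measure (E d) := uniSphere (Set.univ : Set (Metric.sphere (0 : E d) 1))

open scoped Pointwise in
-- The spherical measure of a set is a multiple of the volume of the cone over it; a linear isometry
-- maps cones to cones and preserves volume.
lemma toSphere_preimage_isometry {d : ℕ} (L : E d ≃ₗᵢ[ℝ] E d) {A : Set (E d)}
    (hA : MeasurableSet A) :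
    (volume : Measure (E d)).toSphere (Subtype.val ⁻¹' (L ⁻¹' A)) =
      (volume : Measure (E d)).toSphere (Subtype.val ⁻¹' A) := by
  have hL : Measurable L := L.continuous.measurable
  rw [Measure.toSphere_apply' _ (measurable_subtype_coe (hL hA)),
    Measure.toSphere_apply' _ (measurable_subtype_coe hA)]
  have hset : Set.Ioo (0 : ℝ) 1 • (Subtype.val '' ((Subtype.val : Metric.sphere (0 : E d) 1 → E d) ⁻¹'
        (L ⁻¹' A))) =
      L ⁻¹' (Set.Ioo (0 : ℝ) 1 • (Subtype.val '' ((Subtype.val : Metric.sphere (0 : E d) 1 → E d) ⁻¹'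
        A))) := by
    simp only [Subtype.image_preimage_coe]
    ext x
    simp only [Set.mem_smul, Set.mem_preimage, Set.mem_inter_iff, mem_sphere_zero_iff_norm]
    constructor
    · rintro ⟨c, hc, u, ⟨hu, hu'⟩, rfl⟩
      exact ⟨c, hc, L u, ⟨by simpa using hu, hu'⟩, by simp⟩
    · rintro ⟨c, hc, u, ⟨hu, hu'⟩, h⟩
      refine ⟨c, hc, L.symm u, ⟨by simpa using hu, by simpa using hu'⟩, L.injective ?_⟩
      simpa using h
  rw [hset]
  congr 1
  exact L.measurePreserving.measure_preimage_equiv (f := L.toMeasurableEquiv) _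

lemma sphereUnif_apply {d : ℕ} {A : Set (E d)} (hA : MeasurableSet A) :
    sphereUnif d A = ((volume : Measure (E d)).toSphere Set.univ)⁻¹ *
      (volume : Measure (E d)).toSphere (Subtype.val ⁻¹' A) := by
  rw [sphereUnif, uniSphere, Measure.map_apply measurable_subtype_coe hA,
    ProbabilityTheory.cond_apply MeasurableSet.univ, Set.univ_inter]

lemma measurableSet_pos {d : ℕ} (v : E d) : MeasurableSet {u : E d | 0 < inner ℝ u v} :=
  measurableSet_lt measurable_const (by fun_prop)

lemma measurableSet_nonpos {d : ℕ} (v : E d) : MeasurableSet {u : E d | inner ℝ u v ≤ 0} :=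
  measurableSet_le (by fun_prop) measurable_const

section
variable {d : ℕ} [NeZero d]

lemma toSphere_univ_ne_zero : (volume : Measure (E d)).toSphere Set.univ ≠ 0 := by
  have : Nonempty (Fin d) := ⟨0⟩
  rw [Measure.measure_univ_ne_zero]
  exact Measure.toSphere_ne_zero _

instance : IsProbabilityMeasure (sphereUnif d) := by
  constructor
  rw [sphereUnif_apply MeasurableSet.univ, Set.preimage_univ]
  exact ENNReal.inv_mul_cancel toSphere_univ_ne_zero (measure_ne_top _ _)

lemma sphereUnif_map (L : E d ≃ₗᵢ[ℝ] E d) : (sphereUnif d).map L = sphereUnif d := by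
  ext A hA
  have hL : Measurable L := L.continuous.measurable
  rw [Measure.map_apply hL hA, sphereUnif_apply (hL hA), sphereUnif_apply hA,
    toSphere_preimage_isometry L hA]

lemma integral_sphereUnif_comp (L : E d ≃ₗᵢ[ℝ] E d) (f : E d → ℝ) :
    ∫ u, f (L u) ∂sphereUnif d = ∫ u, f u ∂sphereUnif d := by
  have : MeasurePreserving L.toMeasurableEquiv (sphereUnif d) (sphereUnif d) :=
    ⟨L.continuous.measurable, sphereUnif_map L⟩
  exact this.integral_comp' (g := f)

lemma norm_eq_one_ae : ∀ᵐ u ∂sphereUnif d, ‖u‖ = 1 := by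
  have hm : MeasurableSet {u : E d | ¬ ‖u‖ = 1} :=
    (measurableSet_eq_fun measurable_norm measurable_const).compl
  rw [ae_iff, sphereUnif_apply hm]
  have : (Subtype.val ⁻¹' {u : E d | ¬ ‖u‖ = 1} : Set (Metric.sphere (0 : E d) 1)) = ∅ := by
    ext u; simp
  rw [this]; simp

/-- The cone over this set lies in the proper subspace orthogonal to `v`, which has volume zero. -/
lemma sphereUnif_hyperplane {v : E d} (hv : v ≠ 0) : sphereUnif d {u | inner ℝ u v = 0} = 0 := by
  have hm : MeasurableSet {u : E d | inner ℝ u v = 0} :=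
    measurableSet_eq_fun (by fun_prop) measurable_const
  rw [sphereUnif_apply hm, Measure.toSphere_apply' _ (measurable_subtype_coe hm)]
  have : (volume : Measure (E d)) ((ℝ ∙ v)ᗮ : Submodule ℝ (E d)) = 0 := by
    refine Measure.addHaar_submodule _ _ fun h => hv ?_
    have : v ∈ (ℝ ∙ v)ᗮ := h ▸ Submodule.mem_top
    rwa [Submodule.mem_orthogonal_singleton_iff_inner_right, inner_self_eq_zero] at this
  rw [measure_mono_null ?_ this, mul_zero, mul_zero]
  rintro _ ⟨c, -, _, ⟨u, hu, rfl⟩, rfl⟩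
  have hu : inner ℝ (u : E d) v = 0 := hu
  simp [Submodule.mem_orthogonal_singleton_iff_inner_left, real_inner_smul_left, hu]

/-- The antipodal map exchanges the two open hemispheres, and their common boundary is null. -/
lemma sphereUnif_halves {v : E d} (hv : v ≠ 0) :
    sphereUnif d {u | 0 < inner ℝ u v} = 2⁻¹ ∧ sphereUnif d {u | inner ℝ u v ≤ 0} = 2⁻¹ := by
  have hneg : sphereUnif d {u | inner ℝ u v < 0} = sphereUnif d {u | 0 < inner ℝ u v} := by
    conv_rhs => rw [← sphereUnif_map (LinearIsometryEquiv.neg ℝ (E := E d))]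
    rw [Measure.map_apply (LinearIsometryEquiv.continuous _).measurable (measurableSet_pos v)]
    simp
  have hle : sphereUnif d {u | inner ℝ u v ≤ 0} = sphereUnif d {u | 0 < inner ℝ u v} := by
    rw [← hneg]
    refine le_antisymm ?_ (measure_mono (Set.ofPred_subset_ofPred.2 fun u hu => hu.le))
    calc _ ≤ sphereUnif d ({u | inner ℝ u v < 0} ∪ {u | inner ℝ u v = 0}) :=
          measure_mono fun u hu => by
            simpa [le_iff_lt_or_eq] using hu
      _ ≤ _ := (measure_union_le _ _).trans (by rw [sphereUnif_hyperplane hv, add_zero])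
  have hsum : sphereUnif d {u | 0 < inner ℝ u v} + sphereUnif d {u | inner ℝ u v ≤ 0} = 1 := by
    have := measure_add_measure_compl (μ := sphereUnif d) (measurableSet_pos v)
    rw [measure_univ] at this
    convert this using 3
    ext u; simp
  rw [hle, ← two_mul] at hsum
  have h : sphereUnif d {u | 0 < inner ℝ u v} = 2⁻¹ := by
    rw [ENNReal.eq_inv_of_mul_eq_one_left (a := sphereUnif d {u | 0 < inner ℝ u v}) (b := 2)]
    rw [mul_comm]; exact hsum
  exact ⟨h, hle.trans h⟩

lemma uniSphere_preimage {B : Set (E d)} (hB : MeasurableSet B) (h : sphereUnif d B = 2⁻¹) :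
    uniSphere (Subtype.val ⁻¹' B) = (2 : ℝ≥0∞) • (sphereUnif d).restrict B := by
  ext S hS
  rw [Measure.smul_apply, Measure.restrict_apply hS, sphereUnif_apply (hS.inter hB), uniSphere,
    Measure.map_apply measurable_subtype_coe hS,
    ProbabilityTheory.cond_apply (measurable_subtype_coe hB)]
  rw [sphereUnif_apply hB] at h
  set c := (volume : Measure (E d)).toSphere Set.univ with hc
  set b := (volume : Measure (E d)).toSphere (Subtype.val ⁻¹' B)
  have hc0 : c ≠ 0 := toSphere_univ_ne_zero
  have hct : c ≠ ⊤ := measure_ne_top _ _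
  have hb : b⁻¹ = 2 * c⁻¹ := by
    have : b = c * 2⁻¹ := by
      rw [← h, ← mul_assoc, ENNReal.mul_inv_cancel hc0 hct, one_mul]
    rw [this, ENNReal.mul_inv (by simp) (by simp), inv_inv, mul_comm]
  rw [hb, Set.preimage_inter, Set.inter_comm, smul_eq_mul, mul_assoc]

/-- `hemisphere` has a two-valued density with respect to the uniform distribution. -/
lemma hemisphere_eq {ε : ℝ} {v : E d} (hv : v ≠ 0) :
    hemisphere ε v =
      ENNReal.ofReal (2 * (Real.exp ε / (Real.exp ε + 1))) •
        (sphereUnif d).restrict {u | 0 < inner ℝ u v} +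
      ENNReal.ofReal (2 * (1 / (Real.exp ε + 1))) •
        (sphereUnif d).restrict {u | inner ℝ u v ≤ 0} := by
  have h := sphereUnif_halves hv
  have e1 := uniSphere_preimage (measurableSet_pos v) h.1
  have e2 := uniSphere_preimage (measurableSet_nonpos v) h.2
  simp only [Set.preimage_ofPred_eq] at e1 e2
  have : ENNReal.ofReal 2 = 2 := by simp
  rw [hemisphere, e1, e2, smul_smul, smul_smul, ENNReal.ofReal_mul (by norm_num),
    ENNReal.ofReal_mul (by norm_num), this, mul_comm, mul_comm (ENNReal.ofReal (1 / _))]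

lemma restrict_add_restrict_sphereUnif (v : E d) :
    (sphereUnif d).restrict {u | 0 < inner ℝ u v} +
      (sphereUnif d).restrict {u | inner ℝ u v ≤ 0} = sphereUnif d := by
  have : {u : E d | inner ℝ u v ≤ 0} = {u | 0 < inner ℝ u v}ᶜ := by ext u; simp
  rw [this, Measure.restrict_add_restrict_compl (measurableSet_pos v)]

end

/-! ### Privacy -/

section
variable {d : ℕ} [NeZero d]

/-- For `ε ≥ 0` the weight of the positive half is the larger one. The bound does not involve `v`,
so it survives mixing over the random sign. -/
lemma hemisphere_le {ε : ℝ} (hε : 0 ≤ ε) {v : E d} (hv : v ≠ 0) (S : Set (E d)) :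
    hemisphere ε v S ≤
      ENNReal.ofReal (2 * (Real.exp ε / (Real.exp ε + 1))) * sphereUnif d S := by
  have h1 : (1 : ℝ) ≤ Real.exp ε := Real.one_le_exp hε
  have h : hemisphere ε v ≤
      ENNReal.ofReal (2 * (Real.exp ε / (Real.exp ε + 1))) • sphereUnif d := by
    conv_rhs => rw [← restrict_add_restrict_sphereUnif v]
    rw [hemisphere_eq hv, smul_add]
    gcongr
  exact h S

lemma le_hemisphere {ε : ℝ} (hε : 0 ≤ ε) {v : E d} (hv : v ≠ 0) (S : Set (E d)) :
    ENNReal.ofReal (2 * (1 / (Real.exp ε + 1))) * sphereUnif d S ≤ hemisphere ε v S := by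
  have h1 : (1 : ℝ) ≤ Real.exp ε := Real.one_le_exp hε
  have h : ENNReal.ofReal (2 * (1 / (Real.exp ε + 1))) • sphereUnif d ≤ hemisphere ε v := by
    conv_lhs => rw [← restrict_add_restrict_sphereUnif v]
    rw [hemisphere_eq hv, smul_add]
    gcongr
  exact h S

lemma signProb_mem (r : ℝ) (x : E d) : 0 ≤ signProb r x ∧ 0 ≤ 1 - signProb r x := by
  have : signProb r x ≤ 1 := max_le zero_le_one (min_le_left _ _)
  exact ⟨le_max_left _ _, by linarith⟩

lemma ofReal_signProb_add (r : ℝ) (x : E d) :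
    ENNReal.ofReal (signProb r x) + ENNReal.ofReal (1 - signProb r x) = 1 := by
  rw [← ENNReal.ofReal_add (signProb_mem r x).1 (signProb_mem r x).2]
  simp

/-- The law of the unit vector drawn by the randomizer. -/
def signedHemisphere (ε r : ℝ) (x : E d) : Measure (E d) :=
  ENNReal.ofReal (signProb r x) • hemisphere ε (direction x) +
    ENNReal.ofReal (1 - signProb r x) • hemisphere ε (-direction x)

lemma signedHemisphere_le {ε : ℝ} (hε : 0 ≤ ε) (r : ℝ) (x : E d) (S : Set (E d)) :
    signedHemisphere ε r x S ≤
      ENNReal.ofReal (2 * (Real.exp ε / (Real.exp ε + 1))) * sphereUnif d S := by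
  have h1 := hemisphere_le hε (direction_ne_zero x) S
  have h2 := hemisphere_le hε (neg_ne_zero.2 (direction_ne_zero x)) S
  simp only [signedHemisphere, Measure.coe_add, Measure.coe_smul, Pi.add_apply, Pi.smul_apply,
    smul_eq_mul]
  calc _ ≤ ENNReal.ofReal (signProb r x) * _ + ENNReal.ofReal (1 - signProb r x) * _ :=
        add_le_add (mul_le_mul_right h1 _) (mul_le_mul_right h2 _)
    _ = _ := by rw [← add_mul, ofReal_signProb_add, one_mul]

lemma le_signedHemisphere {ε : ℝ} (hε : 0 ≤ ε) (r : ℝ) (x : E d) (S : Set (E d)) :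
    ENNReal.ofReal (2 * (1 / (Real.exp ε + 1))) * sphereUnif d S ≤ signedHemisphere ε r x S := by
  have h1 := le_hemisphere hε (direction_ne_zero x) S
  have h2 := le_hemisphere hε (neg_ne_zero.2 (direction_ne_zero x)) S
  simp only [signedHemisphere, Measure.coe_add, Measure.coe_smul, Pi.add_apply, Pi.smul_apply,
    smul_eq_mul]
  calc _ = ENNReal.ofReal (signProb r x) * _ + ENNReal.ofReal (1 - signProb r x) * _ := by
        rw [← add_mul, ofReal_signProb_add, one_mul]
    _ ≤ _ := add_le_add (mul_le_mul_right h1 _) (mul_le_mul_right h2 _)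

/-- Both laws lie between the same two multiples of one measure, whose ratio is `e^ε`. No bound on
the inputs is required because `signProb` is clamped. -/
lemma randomizerLaw_le {ε : ℝ} (hε : 0 ≤ ε) (r : ℝ) (x x' : E d) {S : Set (E d)}
    (hS : MeasurableSet S) :
    randomizerLaw ε r x S ≤ ENNReal.ofReal (Real.exp ε) * randomizerLaw ε r x' S := by
  have e : ∀ x : E d, randomizerLaw ε r x S =
      signedHemisphere ε r x ((fun u => outputRadius d ε r • u) ⁻¹' S) := fun x =>
    Measure.map_apply (measurable_const_smul _) hS
  rw [e, e]
  refine (signedHemisphere_le hε r x _).trans ?_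
  refine le_trans ?_ (mul_le_mul_right (le_signedHemisphere hε r x' _) _)
  rw [← mul_assoc, ← ENNReal.ofReal_mul (Real.exp_pos _).le]
  refine mul_le_mul_left (ENNReal.ofReal_le_ofReal (le_of_eq ?_)) _
  ring

/-- For a fixed history, the user's datum enters only through the vector given to the randomizer. -/
lemma ldpIHT_isLDP (A : Params) (n : ℕ) (hε : 0 ≤ A.ε) : (ldpIHT A n d).IsLDP A.ε :=
  fun _ _ _ _ _ hS => randomizerLaw_le hε _ _ _ hS

end

/-! ### Moments of the uniform distribution on the sphere -/

section
variable {d : ℕ} [NeZero d]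

/-- Polar coordinates for a product of an angular and a radial factor. Gaussian radial weights
reduce spherical moments to one-dimensional integrals. -/
lemma integral_polar (f : E d → ℝ) (g : ℝ → ℝ) :
    ∫ x : E d, f (‖x‖⁻¹ • x) * g ‖x‖ =
      (∫ u, f (u : E d) ∂(volume : Measure (E d)).toSphere) *
        ∫ y in Set.Ioi (0 : ℝ), y ^ (d - 1) * g y := by
  have : Nonempty (Fin d) := ⟨0⟩
  have hdim : Module.finrank ℝ (E d) = d := by simp
  calc ∫ x : E d, f (‖x‖⁻¹ • x) * g ‖x‖
      = ∫ x : ({(0)}ᶜ : Set (E d)), f (‖x.1‖⁻¹ • x.1) * g ‖x.1‖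
          ∂((volume : Measure (E d)).comap (↑)) := by
        rw [integral_subtype_comap (measurableSet_singleton _).compl
          fun x : E d => f (‖x‖⁻¹ • x) * g ‖x‖, restrict_compl_singleton]
    _ = ∫ x, f x.1 * g x.2 ∂(volume : Measure (E d)).toSphere.prod
          (.volumeIoiPow (Module.finrank ℝ (E d) - 1)) := by
        simpa using (volume : Measure (E d)).measurePreserving_homeomorphUnitSphereProd.integral_comp
          (Homeomorph.measurableEmbedding _) (fun p => f p.1 * g p.2)
    _ = (∫ u, f (u : E d) ∂(volume : Measure (E d)).toSphere) *
        ∫ y : Set.Ioi (0 : ℝ), g y ∂.volumeIoiPow (Module.finrank ℝ (E d) - 1) := by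
        rw [← integral_prod_mul (fun u : Metric.sphere (0 : E d) 1 => f u)
          (fun y : Set.Ioi (0 : ℝ) => g y)]
    _ = _ := by
        congr 1
        simp only [Measure.volumeIoiPow, ENNReal.ofReal, hdim]
        rw [integral_withDensity_eq_integral_smul,
          integral_subtype_comap measurableSet_Ioi fun a ↦ Real.toNNReal (a ^ (d - 1)) • g a,
          setIntegral_congr_fun measurableSet_Ioi fun x hx ↦ ?_]
        · rw [NNReal.smul_def, Real.coe_toNNReal _ (pow_nonneg hx.out.le _), smul_eq_mul]
        · exact (measurable_subtype_coe.pow_const _).real_toNNReal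

lemma integral_pow_mul_exp_neg_sq (m : ℕ) :
    ∫ y in Set.Ioi (0 : ℝ), y ^ m * Real.exp (-y ^ 2) = Real.Gamma (((m : ℝ) + 1) / 2) / 2 := by
  have h := integral_rpow_mul_exp_neg_rpow (p := 2) (q := m) (by norm_num)
    (by have : (0 : ℝ) ≤ m := m.cast_nonneg
        linarith)
  simp only [Real.rpow_natCast, Real.rpow_two] at h
  rw [h]; ring

lemma integral_exp_neg_norm_sq : ∫ x : E d, Real.exp (-‖x‖ ^ 2) = Real.sqrt Real.pi ^ d := by
  rw [← (PiLp.volume_preserving_toLp (Fin d)).integral_comp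
    (MeasurableEquiv.toLp 2 (Fin d → ℝ)).measurableEmbedding]
  have : ∀ x : Fin d → ℝ, Real.exp (-‖(WithLp.toLp 2 x : E d)‖ ^ 2) =
      ∏ i, Real.exp (-1 * x i ^ 2) := fun x => by
    rw [EuclideanSpace.norm_sq_eq, ← Real.exp_sum, ← Finset.sum_neg_distrib]
    simp
  simp_rw [this]
  rw [integral_fintype_prod_volume_eq_pow (fun t : ℝ => Real.exp (-1 * t ^ 2)), integral_gaussian]
  simp

lemma integral_abs_mul_exp_neg_sq : ∫ t : ℝ, |t| * Real.exp (-1 * t ^ 2) = 1 := by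
  have h := integral_comp_abs (f := fun t : ℝ => t * Real.exp (-t ^ 2))
  have h2 := integral_pow_mul_exp_neg_sq 1
  simp only [sq_abs, pow_one] at h h2
  simp only [neg_mul, one_mul]
  rw [h, h2]
  norm_num

lemma integral_abs_mul_exp_neg_norm_sq :
    ∫ x : E d, |x 0| * Real.exp (-‖x‖ ^ 2) = Real.sqrt Real.pi ^ (d - 1) := by
  rw [← (PiLp.volume_preserving_toLp (Fin d)).integral_comp
    (MeasurableEquiv.toLp 2 (Fin d → ℝ)).measurableEmbedding]
  have : ∀ x : Fin d → ℝ, |(WithLp.toLp 2 x : E d) 0| * Real.exp (-‖(WithLp.toLp 2 x : E d)‖ ^ 2) =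
      ∏ i, (if i = 0 then |x i| else 1) * Real.exp (-1 * x i ^ 2) := fun x => by
    rw [Finset.prod_mul_distrib, Finset.prod_ite_eq', EuclideanSpace.norm_sq_eq, ← Real.exp_sum,
      ← Finset.sum_neg_distrib]
    simp
  simp_rw [this]
  rw [integral_fintype_prod_volume_eq_prod
    (fun (i : Fin d) (t : ℝ) => (if i = 0 then |t| else 1) * Real.exp (-1 * t ^ 2)),
    ← Finset.mul_prod_erase _ _ (Finset.mem_univ 0)]
  rw [Finset.prod_congr rfl (g := fun _ => Real.sqrt Real.pi)]
  · simp only [if_true, integral_abs_mul_exp_neg_sq]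
    simp
  · intro i hi
    rw [Finset.mem_erase] at hi
    simp only [hi.1, if_false, one_mul, integral_gaussian, div_one]

lemma integral_sphereUnif (f : E d → ℝ) (hf : Continuous f) :
    ∫ u, f u ∂sphereUnif d = ((volume : Measure (E d)).toSphere.real Set.univ)⁻¹ *
      ∫ u, f (u : E d) ∂(volume : Measure (E d)).toSphere := by
  rw [sphereUnif, uniSphere, integral_map measurable_subtype_coe.aemeasurable
    hf.aestronglyMeasurable, ProbabilityTheory.cond, integral_smul_measure]
  simp [Measure.real]

/-- The mean of `|⟪u, v⟫|` for a uniform unit vector `u` and a fixed unit vector `v`. -/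
def absMean (d : ℕ) : ℝ :=
  Real.Gamma ((d : ℝ) / 2) / (Real.sqrt Real.pi * Real.Gamma (((d : ℝ) + 1) / 2))

/-- Both `e^(-‖x‖²)` and `|x 0| e^(-‖x‖²)` are integrated as products over coordinates and in polar
form. The quotient of the two identities isolates the spherical mean. -/
lemma integral_abs_coord : ∫ u, |u 0| ∂sphereUnif d = absMean d := by
  rw [integral_sphereUnif _ (by fun_prop)]
  have hd : 0 < d := Nat.pos_of_ne_zero (NeZero.ne d)
  have hd' : (0 : ℝ) < d := by exact_mod_cast hd
  have h1 := integral_polar (d := d) (fun _ => 1) (fun y => Real.exp (-y ^ 2))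
  -- The extra radial factor `y` undoes the normalization of `x` inside the angular factor.
  have h2 := integral_polar (d := d) (fun u => |u 0|) (fun y => y * Real.exp (-y ^ 2))
  have e2 : ∀ x : E d, |(‖x‖⁻¹ • x) 0| * (‖x‖ * Real.exp (-‖x‖ ^ 2)) =
      |x 0| * Real.exp (-‖x‖ ^ 2) := fun x => by
    by_cases hx : x = 0
    · simp [hx]
    · have : ‖x‖ ≠ 0 := norm_ne_zero_iff.2 hx
      simp only [PiLp.smul_apply, smul_eq_mul, abs_mul, abs_inv, abs_norm]
      field_simp
  have e3 : ∀ y : ℝ, y ^ (d - 1) * (y * Real.exp (-y ^ 2)) = y ^ d * Real.exp (-y ^ 2) :=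
    fun y => by rw [← mul_assoc, ← pow_succ, Nat.sub_add_cancel hd]
  simp only [one_mul] at h1
  simp only [e2, e3] at h2
  rw [integral_exp_neg_norm_sq, integral_pow_mul_exp_neg_sq] at h1
  rw [integral_abs_mul_exp_neg_norm_sq, integral_pow_mul_exp_neg_sq] at h2
  rw [Nat.cast_pred hd, sub_add_cancel] at h1
  have g1 : 0 < Real.Gamma ((d : ℝ) / 2) := Real.Gamma_pos_of_pos (by positivity)
  have g2 : 0 < Real.Gamma (((d : ℝ) + 1) / 2) := Real.Gamma_pos_of_pos (by positivity)
  have hp : 0 < Real.sqrt Real.pi := Real.sqrt_pos.2 Real.pi_pos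
  set S := ∫ _u, (1 : ℝ) ∂(volume : Measure (E d)).toSphere with hS
  have hS' : (volume : Measure (E d)).toSphere.real Set.univ = S := by simp [hS]
  set I := ∫ u, |(u : E d) 0| ∂(volume : Measure (E d)).toSphere
  have hpd : Real.sqrt Real.pi ^ d = Real.sqrt Real.pi ^ (d - 1) * Real.sqrt Real.pi := by
    rw [← pow_succ, Nat.sub_add_cancel hd]
  rw [hpd, h2] at h1
  have hI : 0 < I := by
    have : 0 < I * (Real.Gamma (((d : ℝ) + 1) / 2) / 2) := h2 ▸ by positivity
    exact pos_of_mul_pos_left this (by positivity)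
  have hS0 : S ≠ 0 := by
    intro h0
    rw [h0, zero_mul] at h1
    have : 0 < I * (Real.Gamma (((d : ℝ) + 1) / 2) / 2) * Real.sqrt Real.pi := by positivity
    linarith
  rw [hS', absMean, eq_div_iff (by positivity), inv_mul_eq_div, div_mul_eq_mul_div,
    div_eq_iff hS0]
  linarith

lemma exists_isometry_apply_eq {v w : E d} (h : ‖v‖ = ‖w‖) : ∃ L : E d ≃ₗᵢ[ℝ] E d, L v = w :=
  ⟨_, Submodule.reflection_sub h⟩

lemma integral_inner_eq {v w : E d} (h : ‖v‖ = ‖w‖) (f : ℝ → ℝ) :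
    ∫ u, f (inner ℝ u v) ∂sphereUnif d = ∫ u, f (inner ℝ u w) ∂sphereUnif d := by
  obtain ⟨L, hL⟩ := exists_isometry_apply_eq h
  rw [← integral_sphereUnif_comp L (fun u => f (inner ℝ u w))]
  simp [← hL]

lemma integral_abs_inner {v : E d} (hv : ‖v‖ = 1) :
    ∫ u, |inner ℝ u v| ∂sphereUnif d = absMean d := by
  rw [← integral_abs_coord, integral_inner_eq (w := EuclideanSpace.single 0 1) (by simp [hv])
    (fun t => |t|)]
  simp [EuclideanSpace.inner_single_right]

lemma integrable_inner_sphereUnif (w : E d) : Integrable (fun u => inner ℝ u w) (sphereUnif d) := by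
  refine Integrable.of_bound (by fun_prop) ‖w‖ ?_
  filter_upwards [norm_eq_one_ae] with u hu
  simpa [hu] using norm_inner_le_norm (𝕜 := ℝ) u w

lemma integrable_coord_sq_sphereUnif (j : Fin d) :
    Integrable (fun u => u j ^ 2) (sphereUnif d) := by
  refine Integrable.of_bound (by fun_prop) 1 ?_
  filter_upwards [norm_eq_one_ae] with u hu
  have := PiLp.norm_apply_le u j
  rw [norm_pow]
  exact pow_le_one₀ (norm_nonneg _) (by rwa [hu] at this)

/-- By rotation invariance all coordinates have the same second moment, and the squares sum to `1`.
-/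
lemma integral_coord_sq (j : Fin d) : ∫ u, u j ^ 2 ∂sphereUnif d = (d : ℝ)⁻¹ := by
  have h : ∀ i, ∫ u, u i ^ 2 ∂sphereUnif d = ∫ u, u j ^ 2 ∂sphereUnif d := fun i => by
    have := integral_inner_eq (v := EuclideanSpace.single i (1 : ℝ))
      (w := EuclideanSpace.single j (1 : ℝ)) (by simp) (fun t => t ^ 2)
    simpa [EuclideanSpace.inner_single_right] using this
  have hs : ∑ i, ∫ u, u i ^ 2 ∂sphereUnif d = 1 := by
    rw [← integral_finsetSum _ fun i _ => integrable_coord_sq_sphereUnif i]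
    calc _ = ∫ _u, (1 : ℝ) ∂sphereUnif d := by
          refine integral_congr_ae ?_
          filter_upwards [norm_eq_one_ae] with u hu
          have := EuclideanSpace.norm_sq_eq u
          rw [hu] at this
          simpa using this.symm
      _ = 1 := by simp
  simp only [h, Finset.sum_const, Finset.card_univ, Fintype.card_fin, nsmul_eq_mul] at hs
  exact eq_inv_of_mul_eq_one_right hs

lemma integral_inner_sphereUnif (w : E d) : ∫ u, inner ℝ u w ∂sphereUnif d = 0 := by
  have := integral_sphereUnif_comp (LinearIsometryEquiv.neg ℝ (E := E d)) (fun u => inner ℝ u w)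
  simp only [LinearIsometryEquiv.coe_neg, inner_neg_left, integral_neg] at this
  linarith

lemma setIntegral_add_halves {v : E d} (f : E d → ℝ) (hf : Integrable f (sphereUnif d)) :
    ∫ u in {u | 0 < inner ℝ u v}, f u ∂sphereUnif d +
      ∫ u in {u | inner ℝ u v ≤ 0}, f u ∂sphereUnif d = ∫ u, f u ∂sphereUnif d := by
  have : {u : E d | inner ℝ u v ≤ 0} = {u | 0 < inner ℝ u v}ᶜ := by ext u; simp
  rw [this, integral_add_compl (measurableSet_pos v) hf]

/-- The integrals over the two halves sum to `0`, and their absolute values sum to `absMean d`. -/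
lemma setIntegral_pos_inner_self {v : E d} (hv : ‖v‖ = 1) :
    ∫ u in {u | 0 < inner ℝ u v}, inner ℝ u v ∂sphereUnif d = absMean d / 2 := by
  have h1 := setIntegral_add_halves (v := v) _ (integrable_inner_sphereUnif v)
  have h2 := setIntegral_add_halves (v := v) _ (integrable_inner_sphereUnif v).abs
  rw [integral_inner_sphereUnif] at h1
  rw [integral_abs_inner hv,
    setIntegral_congr_fun (g := fun u => inner ℝ u v) (measurableSet_pos v)
      (fun u hu => abs_of_pos (by simpa using hu)),
    setIntegral_congr_fun (g := fun u => -inner ℝ u v) (measurableSet_nonpos v)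
      (fun u hu => abs_of_nonpos (by simpa using hu)), integral_neg] at h2
  linarith

/-- The reflection in the line through `v` preserves the half-space and the uniform law, and changes
the sign of `⟪u, w⟫`. -/
lemma setIntegral_pos_inner_orthogonal {v w : E d} (hw : inner ℝ v w = 0) :
    ∫ u in {u | 0 < inner ℝ u v}, inner ℝ u w ∂sphereUnif d = 0 := by
  set L := (ℝ ∙ v).reflection
  have hv : L v = v := Submodule.reflection_mem_subspace_eq_self (Submodule.mem_span_singleton_self v)
  have hw' : L w = -w := by
    refine Submodule.reflection_mem_subspace_orthogonalComplement_eq_neg ?_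
    rwa [Submodule.mem_orthogonal_singleton_iff_inner_right]
  have h := integral_sphereUnif_comp L
    (Set.indicator {u | 0 < inner ℝ u v} fun u => inner ℝ u w)
  have e : ∀ u, Set.indicator {u | 0 < inner ℝ u v} (fun u => inner ℝ u w) (L u) =
      -Set.indicator {u : E d | 0 < inner ℝ u v} (fun u => inner ℝ u w) u := fun u => by
    have e1 : inner ℝ (L u) v = inner ℝ u v := by
      conv_lhs => rw [← hv]
      exact L.inner_map_map u v
    have e2 : inner ℝ (L u) w = -inner ℝ u w := by
      have := L.inner_map_map u w
      rw [hw', inner_neg_right] at this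
      linarith
    simp only [Set.indicator, Set.mem_ofPred_eq, e1, e2]
    split_ifs <;> simp
  simp only [e, integral_neg] at h
  rw [integral_indicator (measurableSet_pos v)] at h
  linarith

lemma setIntegral_pos_inner {v : E d} (hv : ‖v‖ = 1) (w : E d) :
    ∫ u in {u | 0 < inner ℝ u v}, inner ℝ u w ∂sphereUnif d = inner ℝ v w * (absMean d / 2) := by
  have h0 : inner ℝ v (w - inner ℝ v w • v) = 0 := by
    simp [inner_sub_right, inner_smul_right, hv]
  have h := setIntegral_pos_inner_orthogonal h0
  simp only [inner_sub_right, inner_smul_right] at h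
  rw [integral_sub (integrable_inner_sphereUnif w).integrableOn
    ((integrable_inner_sphereUnif v).const_mul _).integrableOn, integral_const_mul,
    setIntegral_pos_inner_self hv] at h
  linarith

lemma setIntegral_nonpos_inner {v : E d} (hv : ‖v‖ = 1) (w : E d) :
    ∫ u in {u | inner ℝ u v ≤ 0}, inner ℝ u w ∂sphereUnif d =
      -(inner ℝ v w * (absMean d / 2)) := by
  have h := setIntegral_add_halves (v := v) _ (integrable_inner_sphereUnif w)
  rw [integral_inner_sphereUnif, setIntegral_pos_inner hv] at h
  linarith

end

/-! ### Moments of the randomizer -/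

section
variable {d : ℕ} [NeZero d]

lemma norm_direction (x : E d) : ‖direction x‖ = 1 := by
  unfold direction
  split_ifs with h
  · simp
  · simp [norm_smul, h]

lemma norm_smul_direction (x : E d) : ‖x‖ • direction x = x := by
  unfold direction
  split_ifs with h
  · simp [h]
  · rw [smul_smul, mul_inv_cancel₀ (norm_ne_zero_iff.2 h), one_smul]

lemma integral_inner_hemisphere (ε : ℝ) {v : E d} (hv : ‖v‖ = 1) (w : E d) :
    ∫ u, inner ℝ u w ∂hemisphere ε v =
      (Real.exp ε - 1) / (Real.exp ε + 1) * absMean d * inner ℝ v w := by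
  have hv0 : v ≠ 0 := fun h => by simp [h] at hv
  have hpos := Real.exp_pos ε
  have hi := integrable_inner_sphereUnif w
  rw [hemisphere_eq hv0, integral_add_measure (hi.integrableOn.smul_measure ENNReal.ofReal_ne_top)
    (hi.integrableOn.smul_measure ENNReal.ofReal_ne_top), integral_smul_measure, integral_smul_measure,
    setIntegral_pos_inner hv, setIntegral_nonpos_inner hv, ENNReal.toReal_ofReal (by positivity),
    ENNReal.toReal_ofReal (by positivity), smul_eq_mul, smul_eq_mul]
  field_simp
  ring

lemma hemisphere_le_smul {ε : ℝ} (hε : 0 ≤ ε) {v : E d} (hv : v ≠ 0) :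
    hemisphere ε v ≤ (2 : ℝ≥0∞) • sphereUnif d := by
  have hpos := Real.exp_pos ε
  refine Measure.le_iff'.2 fun S => (hemisphere_le hε hv S).trans (mul_le_mul_left ?_ _)
  rw [← ENNReal.ofReal_ofNat 2]
  refine ENNReal.ofReal_le_ofReal ?_
  have : Real.exp ε / (Real.exp ε + 1) ≤ 1 := by rw [div_le_one (by positivity)]; linarith
  linarith

/-- The density bound is uniform in `ε`, so second moments are at most twice those of the uniform
law. Null sets of the uniform law are null here too. -/
lemma signedHemisphere_le_smul {ε : ℝ} (hε : 0 ≤ ε) (r : ℝ) (x : E d) :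
    signedHemisphere ε r x ≤ (2 : ℝ≥0∞) • sphereUnif d := by
  have hpos := Real.exp_pos ε
  refine Measure.le_iff'.2 fun S => (signedHemisphere_le hε r x S).trans (mul_le_mul_left ?_ _)
  rw [← ENNReal.ofReal_ofNat 2]
  refine ENNReal.ofReal_le_ofReal ?_
  have : Real.exp ε / (Real.exp ε + 1) ≤ 1 := by rw [div_le_one (by positivity)]; linarith
  linarith

instance (ε r : ℝ) (x : E d) : IsProbabilityMeasure (randomizerLaw ε r x) :=
  isProbabilityMeasure_randomizerLaw ε r x

/-- In the domain the clamp is inactive, and this is the mean of the random sign. For `r = 0` both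
sides vanish by the convention for division by zero. -/
lemma two_signProb_sub_one {r : ℝ} {x : E d} (hx : ‖x‖ ≤ r) :
    2 * signProb r x - 1 = ‖x‖ / r := by
  have h0 : 0 ≤ ‖x‖ / r := div_nonneg (norm_nonneg _) ((norm_nonneg _).trans hx)
  have h1 : ‖x‖ / r ≤ 1 := div_le_one_of_le₀ hx ((norm_nonneg _).trans hx)
  have h2 : ‖x‖ / (2 * r) = ‖x‖ / r / 2 := by rw [mul_comm, div_mul_eq_div_div]
  rw [signProb, h2, min_eq_right (by linarith), max_eq_right (by linarith)]
  ring

lemma integral_inner_signedHemisphere {ε r : ℝ} (hε : 0 ≤ ε) {x : E d} (hx : ‖x‖ ≤ r) (w : E d) :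
    ∫ u, inner ℝ u w ∂signedHemisphere ε r x =
      ‖x‖ / r * ((Real.exp ε - 1) / (Real.exp ε + 1) * absMean d) * inner ℝ (direction x) w := by
  have hi : ∀ v : E d, v ≠ 0 → Integrable (fun u => inner ℝ u w) (hemisphere ε v) := fun v hv =>
    ((integrable_inner_sphereUnif w).smul_measure (by simp)).mono_measure
      (hemisphere_le_smul hε hv)
  have hd := direction_ne_zero x
  rw [signedHemisphere, integral_add_measure ((hi _ hd).smul_measure (by simp))
    ((hi _ (neg_ne_zero.2 hd)).smul_measure (by simp)), integral_smul_measure,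
    integral_smul_measure, integral_inner_hemisphere ε (norm_direction x),
    integral_inner_hemisphere ε (by rw [norm_neg, norm_direction]), inner_neg_left,
    ENNReal.toReal_ofReal (signProb_mem r x).1, ENNReal.toReal_ofReal (signProb_mem r x).2,
    ← two_signProb_sub_one hx, smul_eq_mul, smul_eq_mul]
  ring

lemma absMean_pos : 0 < absMean d := by
  have hd' : (0 : ℝ) < d := by exact_mod_cast Nat.pos_of_ne_zero (NeZero.ne d)
  have g1 : 0 < Real.Gamma ((d : ℝ) / 2) := Real.Gamma_pos_of_pos (by positivity)
  have g2 : 0 < Real.Gamma (((d : ℝ) + 1) / 2) := Real.Gamma_pos_of_pos (by positivity)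
  have hp : 0 < Real.sqrt Real.pi := Real.sqrt_pos.2 Real.pi_pos
  unfold absMean; positivity

lemma outputRadius_eq (ε r : ℝ) :
    outputRadius d ε r = r * ((Real.exp ε + 1) / (Real.exp ε - 1)) * (absMean d)⁻¹ := by
  rw [outputRadius, absMean, inv_div]

lemma randomizerLaw_eq_map (ε r : ℝ) (x : E d) :
    randomizerLaw ε r x = (signedHemisphere ε r x).map (fun u => outputRadius d ε r • u) := rfl

/-- The randomizer is unbiased. -/
lemma integral_coord_randomizerLaw {ε r : ℝ} (hε : 0 < ε) {x : E d} (hx : ‖x‖ ≤ r) (j : Fin d) :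
    ∫ z, z j ∂randomizerLaw ε r x = x j := by
  rw [randomizerLaw_eq_map, integral_map (by fun_prop) (by fun_prop)]
  simp only [PiLp.smul_apply, smul_eq_mul]
  have h := integral_inner_signedHemisphere hε.le hx (EuclideanSpace.single j 1)
  have hx' : ‖x‖ * direction x j = x j := by
    conv_rhs => rw [← norm_smul_direction x]
    simp
  simp only [EuclideanSpace.inner_single_right, conj_trivial, one_mul] at h
  rw [integral_const_mul, h, outputRadius_eq]
  have h1 : 0 < Real.exp ε - 1 := by have := Real.add_one_lt_exp hε.ne'; linarith
  have h2 := absMean_pos (d := d)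
  -- The factor `r` cancels only if it is nonzero; for `r = 0` both the input and the output vanish.
  rcases eq_or_ne r 0 with hr | hr
  · have : x = 0 := norm_le_zero_iff.1 (hr ▸ hx)
    simp [hr, this]
  · rw [← hx']
    have := Real.exp_pos ε
    field_simp

lemma norm_randomizerLaw_ae {ε : ℝ} (hε : 0 ≤ ε) (r : ℝ) (x : E d) :
    ∀ᵐ z ∂randomizerLaw ε r x, ‖z‖ = |outputRadius d ε r| := by
  rw [randomizerLaw_eq_map, ae_map_iff (by fun_prop)
    (measurableSet_eq_fun measurable_norm measurable_const)]
  have hac : signedHemisphere ε r x ≪ sphereUnif d :=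
    (Measure.absolutelyContinuous_of_le (signedHemisphere_le_smul hε r x)).trans
      Measure.smul_absolutelyContinuous
  filter_upwards [hac.ae_le norm_eq_one_ae] with u hu
  rw [norm_smul, hu, mul_one, Real.norm_eq_abs]

lemma abs_coord_randomizerLaw_ae {ε : ℝ} (hε : 0 ≤ ε) (r : ℝ) (x : E d) (j : Fin d) :
    ∀ᵐ z ∂randomizerLaw ε r x, |z j| ≤ |outputRadius d ε r| := by
  filter_upwards [norm_randomizerLaw_ae hε r x] with z hz
  exact hz ▸ PiLp.norm_apply_le z j

/-- The density bound gains a factor of order `d` over the trivial estimate by the squared radius;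
the final rate depends on this gain. -/
lemma integral_coord_sq_randomizerLaw_le {ε : ℝ} (hε : 0 ≤ ε) (r : ℝ) (x : E d) (j : Fin d) :
    ∫ z, z j ^ 2 ∂randomizerLaw ε r x ≤ 2 * outputRadius d ε r ^ 2 / d := by
  rw [randomizerLaw_eq_map, integral_map (by fun_prop) (by fun_prop)]
  simp only [PiLp.smul_apply, smul_eq_mul, mul_pow]
  rw [integral_const_mul]
  have h : ∫ u, u j ^ 2 ∂signedHemisphere ε r x ≤ 2 * (d : ℝ)⁻¹ := by
    refine (integral_mono_measure (signedHemisphere_le_smul hε r x)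
      (Filter.Eventually.of_forall fun u => sq_nonneg (u j))
      ((integrable_coord_sq_sphereUnif j).smul_measure (by simp))).trans (le_of_eq ?_)
    rw [integral_smul_measure, integral_coord_sq]
    simp
  calc _ ≤ outputRadius d ε r ^ 2 * (2 * (d : ℝ)⁻¹) :=
        mul_le_mul_of_nonneg_left h (sq_nonneg _)
    _ = _ := by ring

/-- Bernstein-type bound on the moment generating function of an entry of a message. -/
lemma lintegral_exp_coord_randomizerLaw_le {ε r s : ℝ} (hε : 0 < ε) {x : E d} (hx : ‖x‖ ≤ r)
    (hs : |s| * |outputRadius d ε r| ≤ 1) (j : Fin d) :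
    ∫⁻ z, ENNReal.ofReal (Real.exp (s * z j)) ∂randomizerLaw ε r x ≤
      ENNReal.ofReal (1 + s * x j + s ^ 2 * (2 * outputRadius d ε r ^ 2 / d)) := by
  have hae := abs_coord_randomizerLaw_ae hε.le r x j
  have hi1 : Integrable (fun z : E d => z j) (randomizerLaw ε r x) :=
    Integrable.of_bound (by fun_prop) _ hae
  have hi2 : Integrable (fun z : E d => z j ^ 2) (randomizerLaw ε r x) := by
    refine Integrable.of_bound (by fun_prop) (|outputRadius d ε r| ^ 2) ?_
    filter_upwards [hae] with z hz
    rw [norm_pow, Real.norm_eq_abs]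
    exact pow_le_pow_left₀ (abs_nonneg _) hz 2
  calc _ ≤ ∫⁻ z, ENNReal.ofReal (1 + s * z j + s ^ 2 * z j ^ 2) ∂randomizerLaw ε r x := by
        refine lintegral_mono_ae ?_
        filter_upwards [hae] with z hz
        refine ENNReal.ofReal_le_ofReal ?_
        have h1 : |s * z j| ≤ 1 := by
          rw [abs_mul]
          exact (mul_le_mul_of_nonneg_left hz (abs_nonneg _)).trans hs
        -- The inequality `e^u ≤ 1 + u + u²` for `|u| ≤ 1`.
        have h2 := abs_le.1 (Real.abs_exp_sub_one_sub_id_le h1)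
        nlinarith [h2.2]
    _ = ENNReal.ofReal (∫ z, (1 + s * z j + s ^ 2 * z j ^ 2) ∂randomizerLaw ε r x) := by
        rw [ofReal_integral_eq_lintegral_ofReal]
        · exact ((integrable_const _).add (hi1.const_mul _)).add (hi2.const_mul _)
        · refine Filter.Eventually.of_forall fun z => ?_
          simp only [Pi.zero_apply]
          nlinarith [sq_nonneg (s * z j + 1 / 2)]
    _ ≤ _ := by
        refine ENNReal.ofReal_le_ofReal ?_
        rw [integral_add (f := fun z : E d => 1 + s * z j)
            ((integrable_const _).add (hi1.const_mul _)) (hi2.const_mul _),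
          integral_add (integrable_const _) (hi1.const_mul _), integral_const_mul,
          integral_const_mul, integral_coord_randomizerLaw hε hx]
        have := mul_le_mul_of_nonneg_left (integral_coord_sq_randomizerLaw_le hε.le r x j)
          (sq_nonneg s)
        simp only [integral_const, probReal_univ, smul_eq_mul, mul_one]
        linarith

/-- The output radius is of order `r √d / ε`. -/
lemma outputRadius_le {ε ε₀ r : ℝ} (hε : 0 < ε) (hε₀ : ε ≤ ε₀) (hr : 0 ≤ r) :
    outputRadius d ε r ≤ r * ((Real.exp ε₀ + 1) / ε) * (2 * Real.sqrt d) := by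
  have hd' : (0 : ℝ) < d := by exact_mod_cast Nat.pos_of_ne_zero (NeZero.ne d)
  have g1 : 0 < Real.Gamma ((d : ℝ) / 2) := Real.Gamma_pos_of_pos (by positivity)
  have g2 : 0 < Real.Gamma (((d : ℝ) + 1) / 2) := Real.Gamma_pos_of_pos (by positivity)
  have hG : Real.Gamma (((d : ℝ) + 1) / 2) ≤ Real.Gamma ((d : ℝ) / 2) * Real.sqrt (d / 2) := by
    -- Log-convexity of `Γ` at `(d + 1)/2`, the midpoint of `d/2` and `d/2 + 1`.
    have h := Real.Gamma_mul_add_mul_le_rpow_Gamma_mul_rpow_Gamma (s := (d : ℝ) / 2)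
      (t := (d : ℝ) / 2 + 1) (a := 1 / 2) (b := 1 / 2) (by positivity) (by positivity)
      (by norm_num) (by norm_num) (by norm_num)
    rw [Real.Gamma_add_one (by positivity), Real.mul_rpow (by positivity) g1.le,
      ← Real.sqrt_eq_rpow, ← Real.sqrt_eq_rpow] at h
    have e : (1 / 2 : ℝ) * (d / 2) + 1 / 2 * (d / 2 + 1) = (d + 1) / 2 := by ring
    rw [e] at h
    calc _ ≤ _ := h
      _ = (Real.sqrt (Real.Gamma (d / 2)) * Real.sqrt (Real.Gamma (d / 2))) * Real.sqrt (d / 2) := by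
        ring
      _ = _ := by rw [Real.mul_self_sqrt g1.le]
  have h1 : Real.sqrt Real.pi * Real.Gamma (((d : ℝ) + 1) / 2) / Real.Gamma ((d : ℝ) / 2) ≤
      2 * Real.sqrt d := by
    rw [div_le_iff₀ g1]
    have h2 : Real.sqrt Real.pi * Real.sqrt (d / 2) ≤ 2 * Real.sqrt d := by
      rw [← Real.sqrt_mul Real.pi_pos.le]
      refine Real.sqrt_le_iff.2 ⟨by positivity, ?_⟩
      rw [mul_pow, Real.sq_sqrt hd'.le]
      nlinarith [Real.pi_le_four]
    calc _ ≤ Real.sqrt Real.pi * (Real.Gamma ((d : ℝ) / 2) * Real.sqrt (d / 2)) := by gcongr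
      _ = (Real.sqrt Real.pi * Real.sqrt (d / 2)) * Real.Gamma ((d : ℝ) / 2) := by ring
      _ ≤ _ := by gcongr
  have h3 : (Real.exp ε + 1) / (Real.exp ε - 1) ≤ (Real.exp ε₀ + 1) / ε := by
    have : ε ≤ Real.exp ε - 1 := by have := Real.add_one_le_exp ε; linarith
    have : Real.exp ε ≤ Real.exp ε₀ := Real.exp_le_exp.2 hε₀
    gcongr
  have h4 : 0 ≤ Real.sqrt Real.pi * Real.Gamma (((d : ℝ) + 1) / 2) / Real.Gamma ((d : ℝ) / 2) := by
    positivity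
  have h5 := Real.exp_pos ε₀
  rw [outputRadius]
  gcongr

lemma outputRadius_pos {ε r : ℝ} (hε : 0 < ε) (hr : 0 < r) : 0 < outputRadius d ε r := by
  rw [outputRadius_eq]
  have h1 : 0 < Real.exp ε - 1 := by have := Real.add_one_lt_exp hε.ne'; linarith
  have h2 := absMean_pos (d := d)
  have := Real.exp_pos ε
  positivity

end

/-! ### The effect of shrinkage on sub-Gaussian variables -/

lemma abs_shrink_le_abs {τ : ℝ} (hτ : 0 ≤ τ) (a : ℝ) : |shrink τ a| ≤ |a| := by
  rw [shrink, abs_mul, abs_of_nonneg (le_min (abs_nonneg a) hτ)]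
  rcases lt_trichotomy a 0 with h | h | h
  · simp [Real.sign_of_neg h]
  · simp [h]
  · simp [Real.sign_of_pos h]

lemma abs_shrink_sub {τ : ℝ} (hτ : 0 ≤ τ) (a : ℝ) : |shrink τ a - a| = max (|a| - τ) 0 := by
  have h1 : shrink τ a - a = -(Real.sign a * max (|a| - τ) 0) := by
    have h2 : Real.sign a * |a| = a := by
      rcases lt_trichotomy a 0 with h | h | h
      · simp [Real.sign_of_neg h, abs_of_neg h]
      · simp [h]
      · simp [Real.sign_of_pos h, abs_of_pos h]
    have h3 : min |a| τ = |a| - max (|a| - τ) 0 := by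
      rcases le_total |a| τ with h | h
      · rw [min_eq_left h, max_eq_right (by linarith)]; ring
      · rw [min_eq_right h, max_eq_left (by linarith)]; ring
    rw [shrink, h3, mul_sub, h2]; ring
  rw [h1, abs_neg, abs_mul, abs_of_nonneg (le_max_right (|a| - τ) 0)]
  rcases lt_trichotomy a 0 with h | h | h
  · simp [Real.sign_of_neg h]
  · simp [h, hτ]
  · simp [Real.sign_of_pos h]

/-- The inequality `t² / 2 ≤ e^t` at `t = l(|a| - τ) ≥ 0` replaces the excess over `τ` by
exponentials whose means are moment generating functions. The parameter `l` stays free for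
optimization. -/
lemma sq_shrink_sub_le {τ l : ℝ} (hτ : 0 ≤ τ) (hl : 0 < l) (a : ℝ) :
    (shrink τ a - a) ^ 2 ≤
      2 / l ^ 2 * Real.exp (-(l * τ)) * (Real.exp (l * a) + Real.exp (-l * a)) := by
  have hexp : Real.exp (l * |a|) ≤ Real.exp (l * a) + Real.exp (-l * a) := by
    rcases abs_cases a with ⟨h, -⟩ | ⟨h, -⟩
    · rw [h]; linarith [Real.exp_pos (-l * a)]
    · rw [h, mul_neg, ← neg_mul]; linarith [Real.exp_pos (l * a)]
  have h2 : max (|a| - τ) 0 ^ 2 ≤ 2 / l ^ 2 * Real.exp (l * (|a| - τ)) := by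
    rcases le_total (|a| - τ) 0 with h | h
    · rw [max_eq_right h, zero_pow two_ne_zero]; positivity
    · rw [max_eq_left h, div_mul_eq_mul_div, le_div_iff₀ (by positivity)]
      have := Real.quadratic_le_exp_of_nonneg (x := l * (|a| - τ)) (mul_nonneg hl.le h)
      have h3 : 0 ≤ l * (|a| - τ) := mul_nonneg hl.le h
      nlinarith
  rw [← sq_abs, abs_shrink_sub hτ]
  refine h2.trans ?_
  have : Real.exp (l * (|a| - τ)) = Real.exp (-(l * τ)) * Real.exp (l * |a|) := by
    rw [← Real.exp_add]; congr 1; ring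
  rw [this, ← mul_assoc]
  gcongr

section
variable {Ω : Type*} [MeasurableSpace Ω] {μ : Measure Ω} [IsProbabilityMeasure μ] {X Y : Ω → ℝ}
  {c c' : ℝ≥0}

lemma memLp_two_of_subgaussian (hX : HasSubgaussianMGF X c μ) : MemLp X 2 μ := hX.memLp 2

lemma memLp_shrink_sub (hX : HasSubgaussianMGF X c μ) {τ : ℝ} (hτ : 0 ≤ τ) :
    MemLp (fun ω => shrink τ (X ω) - X ω) 2 μ := by
  refine (memLp_two_of_subgaussian hX).mono
    (((measurable_shrink τ).comp_aemeasurable hX.aemeasurable).sub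
      hX.aemeasurable).aestronglyMeasurable (Filter.Eventually.of_forall fun ω => ?_)
  rw [Real.norm_eq_abs, abs_shrink_sub hτ, Real.norm_eq_abs]
  exact max_le (by linarith) (abs_nonneg _)

lemma integral_sq_shrink_sub_le (hX : HasSubgaussianMGF X c μ) {τ l : ℝ} (hτ : 0 ≤ τ)
    (hl : 0 < l) :
    ∫ ω, (shrink τ (X ω) - X ω) ^ 2 ∂μ ≤ 4 / l ^ 2 * Real.exp (c * l ^ 2 / 2 - l * τ) := by
  calc _ ≤ ∫ ω, 2 / l ^ 2 * Real.exp (-(l * τ)) *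
        (Real.exp (l * X ω) + Real.exp (-l * X ω)) ∂μ := by
        refine integral_mono (memLp_shrink_sub hX hτ).integrable_sq
          (((hX.integrable_exp_mul l).add (hX.integrable_exp_mul (-l))).const_mul _)
          fun ω => sq_shrink_sub_le hτ hl _
    _ = 2 / l ^ 2 * Real.exp (-(l * τ)) * (mgf X μ l + mgf X μ (-l)) := by
        rw [integral_const_mul, integral_add (hX.integrable_exp_mul l) (hX.integrable_exp_mul (-l))]
        rfl
    _ ≤ 2 / l ^ 2 * Real.exp (-(l * τ)) *
        (Real.exp (c * l ^ 2 / 2) + Real.exp (c * l ^ 2 / 2)) := by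
        have h1 := hX.mgf_le l
        have h2 := hX.mgf_le (-l)
        rw [neg_sq] at h2
        gcongr
    _ = _ := by
        rw [sub_eq_add_neg, Real.exp_add]; ring

/-- The function `e^(ct²/2) - mgf X μ t` is nonnegative and vanishes at `t = 0`, so its derivative
there, which is minus the mean, is zero. -/
lemma integral_eq_zero_of_subgaussian (hX : HasSubgaussianMGF X c μ) : ∫ ω, X ω ∂μ = 0 := by
  have hint : (0 : ℝ) ∈ interior (integrableExpSet X μ) := by
    rw [hX.integrableExpSet_eq_univ]; simp
  have h1 : HasDerivAt (mgf X μ) (∫ ω, X ω ∂μ) 0 := by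
    simpa using hasDerivAt_mgf hint
  have h2 : HasDerivAt (fun t : ℝ => Real.exp (c * t ^ 2 / 2)) 0 0 := by
    have : HasDerivAt (fun t : ℝ => (c : ℝ) * t ^ 2 / 2) ((c : ℝ) * (2 * 0) / 2) 0 := by
      simpa using ((hasDerivAt_pow 2 (0 : ℝ)).const_mul (c : ℝ)).div_const 2
    simpa using this.exp
  have hmin : IsLocalMin ((fun t : ℝ => Real.exp (c * t ^ 2 / 2)) - mgf X μ) 0 :=
    Filter.Eventually.of_forall fun t => by
      have := hX.mgf_le t
      simp only [Pi.sub_apply]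
      simp
      linarith
  have := hmin.hasDerivAt_eq_zero (h2.sub h1)
  linarith

lemma integral_abs_mul_le {t : ℝ} (ht : 0 < t) (hX : MemLp X 2 μ) (hY : MemLp Y 2 μ) :
    ∫ ω, |X ω| * |Y ω| ∂μ ≤ (t * ∫ ω, X ω ^ 2 ∂μ + t⁻¹ * ∫ ω, Y ω ^ 2 ∂μ) / 2 := by
  rw [← integral_const_mul, ← integral_const_mul,
    ← integral_add (hX.integrable_sq.const_mul _) (hY.integrable_sq.const_mul _),
    ← integral_div]
  refine integral_mono (hX.abs.integrable_mul hY.abs)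
    (((hX.integrable_sq.const_mul _).add (hY.integrable_sq.const_mul _)).div_const _) fun ω => ?_
  have h : 0 ≤ t⁻¹ * (t * |X ω| - |Y ω|) ^ 2 := by positivity
  have e : t⁻¹ * (t * |X ω| - |Y ω|) ^ 2 =
      t * |X ω| ^ 2 + t⁻¹ * |Y ω| ^ 2 - 2 * (|X ω| * |Y ω|) := by
    field_simp; ring
  rw [e, sq_abs, sq_abs] at h
  linarith

lemma integral_sq_le_of_subgaussian {σ : ℝ≥0} (hσ : 0 < σ) (hX : HasSubgaussianMGF X (σ ^ 2) μ) :
    ∫ ω, X ω ^ 2 ∂μ ≤ 8 * σ ^ 2 := by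
  have hσ' : (0 : ℝ) < σ := hσ
  -- Shrinkage at level `0` gives `0`, so the shrinkage estimate becomes a second moment bound; `l =
  -- 1/σ`.
  have h := integral_sq_shrink_sub_le hX le_rfl (inv_pos.2 hσ')
  have e : ∀ a, (shrink 0 a - a) ^ 2 = a ^ 2 := fun a => by
    simp [shrink]
  simp only [e] at h
  refine h.trans ?_
  have e2 : ((σ ^ 2 : ℝ≥0) : ℝ) * ((σ : ℝ)⁻¹) ^ 2 / 2 - (σ : ℝ)⁻¹ * 0 = 1 / 2 := by
    push_cast; field_simp; ring
  rw [e2]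
  have h3 : Real.exp (1 / 2) ≤ 2 := by
    have : Real.exp (1 / 2) * Real.exp (1 / 2) = Real.exp 1 := by rw [← Real.exp_add]; norm_num
    nlinarith [Real.exp_one_lt_d9, Real.exp_pos (1 / 2)]
  have e3 : 4 / ((σ : ℝ)⁻¹) ^ 2 = 4 * σ ^ 2 := by field_simp
  rw [e3]
  nlinarith [sq_nonneg (σ : ℝ)]

/-- At the level `2 σ √(log n)`, shrinkage moves a sub-Gaussian variable by `O(σ² / n)` against
another one. -/
lemma integral_abs_shrink_sub_mul_le {σ : ℝ≥0} (hσ : 0 < σ) {n : ℕ} (hn : 2 ≤ n)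
    (hX : HasSubgaussianMGF X (σ ^ 2) μ) (hY : HasSubgaussianMGF Y (σ ^ 2) μ) :
    ∫ ω, |shrink (2 * σ * Real.sqrt (Real.log n)) (X ω) - X ω| * |Y ω| ∂μ ≤ 5 * σ ^ 2 / n := by
  have hσ' : (0 : ℝ) < σ := hσ
  have hn' : (2 : ℝ) ≤ n := by exact_mod_cast hn
  have hn0 : (0 : ℝ) < n := by linarith
  have hlog : 1 / 2 ≤ Real.log n := by
    have := Real.log_le_log (by norm_num) hn'
    linarith [Real.log_two_gt_d9]
  have hlog0 : 0 < Real.log n := by linarith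
  have hs0 : 0 < Real.sqrt (Real.log n) := Real.sqrt_pos.2 hlog0
  have hs : Real.sqrt (Real.log n) ^ 2 = Real.log n := Real.sq_sqrt hlog0.le
  have hτ : 0 ≤ 2 * σ * Real.sqrt (Real.log n) := by positivity
  -- The choice `l = τ/σ²` minimizes the exponent `σ²l²/2 - lτ`; the minimum `-2 log n` yields a
  -- factor `n⁻²`.
  have h1 := integral_sq_shrink_sub_le hX hτ
    (l := 2 * Real.sqrt (Real.log n) / σ) (by positivity)
  have e1 : ((σ ^ 2 : ℝ≥0) : ℝ) * (2 * Real.sqrt (Real.log n) / σ) ^ 2 / 2 -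
      2 * Real.sqrt (Real.log n) / σ * (2 * σ * Real.sqrt (Real.log n)) =
      -Real.log n + -Real.log n := by
    push_cast
    field_simp
    linear_combination (-2 : ℝ) * hs
  have e2 : 4 / (2 * Real.sqrt (Real.log n) / σ) ^ 2 = σ ^ 2 / Real.log n := by
    rw [div_pow, mul_pow, hs]; field_simp; ring
  rw [e1, e2, Real.exp_add, Real.exp_neg, Real.exp_log hn0] at h1
  have h2 := integral_sq_le_of_subgaussian hσ hY
  -- The weight `t = n` balances a second moment of order `n⁻²` against one of order `1`.
  have h3 := integral_abs_mul_le (t := n) hn0 (memLp_shrink_sub hX hτ) (memLp_two_of_subgaussian hY)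
  have h4 : (σ : ℝ) ^ 2 / Real.log n ≤ 2 * σ ^ 2 := by
    rw [div_le_iff₀ hlog0]; nlinarith [sq_nonneg (σ : ℝ)]
  refine h3.trans ?_
  calc _ ≤ (n * (2 * σ ^ 2 * ((n : ℝ)⁻¹ * (n : ℝ)⁻¹)) + (n : ℝ)⁻¹ * (8 * σ ^ 2)) / 2 := by
        gcongr
        exact h1.trans (by gcongr)
    _ = _ := by field_simp; ring

end

/-! ### The mean of the clipped gradient -/

section
variable {d k : ℕ} {P : Measure (E d × ℝ)} [IsProbabilityMeasure P] {θs : E d} {σ : ℝ≥0}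

lemma IsSparseModel.subG_coord (h : IsSparseModel P θs k σ) (j : Fin d) :
    HasSubgaussianMGF (fun p : E d × ℝ => p.1 j) (σ ^ 2) P := by
  have := h.subG_x (EuclideanSpace.single j 1) (by simp)
  simpa [EuclideanSpace.inner_single_right] using this

lemma IsSparseModel.integral_coord_mul_coord (h : IsSparseModel P θs k σ) (hc : covX P = 1)
    (i j : Fin d) : ∫ p, p.1 i * p.1 j ∂P = if i = j then 1 else 0 := by
  have hij := congrFun (congrFun hc i) j
  rw [covX, Matrix.of_apply, covariance_eq_sub (memLp_two_of_subgaussian (h.subG_coord i))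
    (memLp_two_of_subgaussian (h.subG_coord j)),
    integral_eq_zero_of_subgaussian (h.subG_coord i), zero_mul, sub_zero,
    Matrix.one_apply] at hij
  exact hij

lemma inner_eq_sum (θ x : E d) : inner ℝ θ x = ∑ l, θ l * x l := by
  rw [PiLp.inner_apply]
  simp [mul_comm]

lemma IsSparseModel.memLp_inner (h : IsSparseModel P θs k σ) (θ : E d) :
    MemLp (fun p : E d × ℝ => inner ℝ θ p.1) 2 P := by
  simp only [inner_eq_sum]
  exact memLp_finsetSum _ fun l _ => (memLp_two_of_subgaussian (h.subG_coord l)).const_mul _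

/-- The entry `x_j` is measurable with respect to `x`, so it can be pulled out of the conditional
expectation of the noise. -/
lemma IsSparseModel.integral_noise_mul (h : IsSparseModel P θs k σ) (j : Fin d) :
    ∫ p, p.1 j * (p.2 - inner ℝ θs p.1) ∂P = 0 := by
  have hm : MeasurableSpace.comap (Prod.fst : E d × ℝ → E d) inferInstance ≤
      (inferInstance : MeasurableSpace (E d × ℝ)) := measurable_fst.comap_le
  have hz : MemLp (fun p : E d × ℝ => p.2 - inner ℝ θs p.1) 2 P :=
    (memLp_two_of_subgaussian h.subG_y).sub (h.memLp_inner θs)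
  have hf : StronglyMeasurable[MeasurableSpace.comap (Prod.fst : E d × ℝ → E d) inferInstance]
      (fun p : E d × ℝ => p.1 j) := by
    have h1 : Measurable fun x : E d => x j := by fun_prop
    exact (h1.comp (comap_measurable _)).stronglyMeasurable
  have h1 := condExp_mul_of_stronglyMeasurable_left hf
    ((memLp_two_of_subgaussian (h.subG_coord j)).integrable_mul hz) (hz.integrable (by norm_num))
  rw [← integral_condExp hm]
  have h2 : P[fun p : E d × ℝ => p.1 j * (p.2 - inner ℝ θs p.1) |
      MeasurableSpace.comap (Prod.fst : E d × ℝ → E d) inferInstance] =ᵐ[P] 0 := by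
    filter_upwards [h1, h.noise] with p hp hn
    have : (P[fun p : E d × ℝ => p.1 j * (p.2 - inner ℝ θs p.1) |
      MeasurableSpace.comap (Prod.fst : E d × ℝ → E d) inferInstance]) p = _ := hp
    rw [this, Pi.mul_apply, hn]; simp
  rw [integral_congr_ae h2]; simp

/-- The gradient of the population risk, by isotropy. -/
lemma IsSparseModel.integral_gradient (h : IsSparseModel P θs k σ) (hc : covX P = 1)
    (θ : E d) (j : Fin d) :
    ∫ p, (inner ℝ θ p.1 - p.2) * p.1 j ∂P = θ j - θs j := by
  have e : ∀ p : E d × ℝ, (inner ℝ θ p.1 - p.2) * p.1 j =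
      ∑ l, (θ l - θs l) * (p.1 l * p.1 j) - p.1 j * (p.2 - inner ℝ θs p.1) := fun p => by
    have : ∑ l, (θ l - θs l) * (p.1 l * p.1 j) = (inner ℝ θ p.1 - inner ℝ θs p.1) * p.1 j := by
      rw [inner_eq_sum, inner_eq_sum, ← Finset.sum_sub_distrib, Finset.sum_mul]
      exact Finset.sum_congr rfl fun l _ => by ring
    rw [this]; ring
  have hi : ∀ l, Integrable (fun p : E d × ℝ => (θ l - θs l) * (p.1 l * p.1 j)) P := fun l =>
    ((memLp_two_of_subgaussian (h.subG_coord l)).integrable_mul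
      (memLp_two_of_subgaussian (h.subG_coord j))).const_mul _
  have hz : MemLp (fun p : E d × ℝ => p.2 - inner ℝ θs p.1) 2 P :=
    (memLp_two_of_subgaussian h.subG_y).sub (h.memLp_inner θs)
  simp only [e]
  rw [integral_sub (g := fun p : E d × ℝ => p.1 j * (p.2 - inner ℝ θs p.1))
    (integrable_finsetSum _ fun l _ => hi l)
    ((memLp_two_of_subgaussian (h.subG_coord j)).integrable_mul hz),
    h.integral_noise_mul, sub_zero,
    integral_finsetSum _ fun l _ => hi l]
  simp [integral_const_mul, h.integral_coord_mul_coord hc]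

/-- A zero proxy would make every coordinate vanish almost surely, contradicting unit variance. -/
lemma IsSparseModel.varianceProxy_pos [NeZero d] (h : IsSparseModel P θs k σ) (hc : covX P = 1) :
    0 < σ := by
  rw [pos_iff_ne_zero]
  rintro rfl
  have h0 := h.subG_coord 0
  rw [zero_pow two_ne_zero] at h0
  have h1 := h0.ae_eq_zero_of_hasSubgaussianMGF_zero
  have h2 := h.integral_coord_mul_coord hc 0 0
  rw [integral_congr_ae (g := fun _ => 0)] at h2
  · simp at h2
  · filter_upwards [h1] with p hp
    simp only [Pi.zero_apply] at hp
    simp [hp]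

/-- The mean of an entry of the clipped gradient. -/
def meanGradient (A : Params) (P : Measure (E d × ℝ)) (θ : E d) (j : Fin d) : ℝ :=
  ∫ p, clippedGradient A θ p j ∂P

lemma measurable_clippedGradient (A : Params) (θ : E d) :
    Measurable fun p : E d × ℝ => clippedGradient A θ p := by
  have h1 : Measurable fun p : E d × ℝ => shrinkVec A.τ₁ p.1 :=
    (measurable_shrinkVec A.τ₁).comp measurable_fst
  have h2 : Measurable fun p : E d × ℝ => shrink A.τ₂ p.2 :=
    (measurable_shrink A.τ₂).comp measurable_snd
  exact ((measurable_const.inner h1).sub h2).smul h1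

/-- A bound on the effect of shrinkage on an entry of the gradient. -/
def shrinkageGap (τ : ℝ) (θ : E d) (j : Fin d) (p : E d × ℝ) : ℝ :=
  ∑ l, (|θ l| * (|shrink τ (p.1 l) - p.1 l| * |p.1 j|) +
    |θ l| * (|shrink τ (p.1 j) - p.1 j| * |p.1 l|)) +
  (|shrink τ p.2 - p.2| * |p.1 j| + |shrink τ (p.1 j) - p.1 j| * |p.2|)

/-- Writing `s` for `shrink τ`, each product is telescoped as `s(a)s(b) - ab = (s(a) - a)s(b) +
(s(b) - b)a`, and `|s(b)| ≤ |b|`. All terms then have the form treated by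
`integral_abs_shrink_sub_mul_le`. -/
lemma abs_clippedGradient_sub_le (A : Params) {τ : ℝ} (hτ : 0 ≤ τ) (h1 : A.τ₁ = τ)
    (h2 : A.τ₂ = τ) (θ : E d) (j : Fin d) (p : E d × ℝ) :
    |clippedGradient A θ p j - (inner ℝ θ p.1 - p.2) * p.1 j| ≤ shrinkageGap τ θ j p := by
  have e : clippedGradient A θ p j - (inner ℝ θ p.1 - p.2) * p.1 j =
      ∑ l, (θ l * ((shrink τ (p.1 l) - p.1 l) * shrink τ (p.1 j)) +
        θ l * ((shrink τ (p.1 j) - p.1 j) * p.1 l)) -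
      ((shrink τ p.2 - p.2) * shrink τ (p.1 j) + (shrink τ (p.1 j) - p.1 j) * p.2) := by
    have e1 : clippedGradient A θ p j =
        (∑ l, θ l * shrink τ (p.1 l) - shrink τ p.2) * shrink τ (p.1 j) := by
      simp [clippedGradient, inner_eq_sum, shrinkVec, h1, h2]
    have e2 : ∑ l, (θ l * ((shrink τ (p.1 l) - p.1 l) * shrink τ (p.1 j)) +
        θ l * ((shrink τ (p.1 j) - p.1 j) * p.1 l)) =
        (∑ l, θ l * shrink τ (p.1 l)) * shrink τ (p.1 j) - (∑ l, θ l * p.1 l) * p.1 j := by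
      rw [Finset.sum_mul, Finset.sum_mul, ← Finset.sum_sub_distrib]
      exact Finset.sum_congr rfl fun l _ => by ring
    rw [e1, e2, inner_eq_sum]; ring
  rw [e]
  have hs := abs_shrink_le_abs hτ (p.1 j)
  refine (abs_sub _ _).trans (add_le_add ?_ ?_)
  · refine (Finset.abs_sum_le_sum_abs _ _).trans (Finset.sum_le_sum fun l _ => ?_)
    refine (abs_add_le _ _).trans (add_le_add ?_ ?_)
    · rw [abs_mul, abs_mul]; gcongr
    · rw [abs_mul, abs_mul]
  · refine (abs_add_le _ _).trans (add_le_add ?_ ?_)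
    · rw [abs_mul]; gcongr
    · rw [abs_mul]
/-- The bias of the clipped gradient. -/
lemma IsSparseModel.abs_meanGradient_sub_le (h : IsSparseModel P θs k σ) (hc : covX P = 1)
    (hσ : 0 < σ) (A : Params) {n : ℕ} (hn : 2 ≤ n)
    (h1 : A.τ₁ = 2 * σ * Real.sqrt (Real.log n)) (h2 : A.τ₂ = 2 * σ * Real.sqrt (Real.log n))
    (θ : E d) (j : Fin d) :
    |meanGradient A P θ j - (θ j - θs j)| ≤ (∑ l, |θ l| + 1) * (10 * σ ^ 2 / n) := by
  set τ := 2 * σ * Real.sqrt (Real.log n) with hτd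
  have hτ : 0 ≤ τ := by positivity
  have hx := h.subG_coord
  have hy := h.subG_y
  have hDx := fun l => memLp_shrink_sub (hx l) hτ
  have hDy := memLp_shrink_sub hy hτ
  have i1 : ∀ l m, Integrable (fun p : E d × ℝ =>
      |θ l| * (|shrink τ (p.1 m) - p.1 m| * |p.1 j|)) P := fun l m =>
    ((hDx m).abs.integrable_mul (memLp_two_of_subgaussian (hx j)).abs).const_mul _
  have i2 : ∀ l, Integrable (fun p : E d × ℝ =>
      |θ l| * (|shrink τ (p.1 j) - p.1 j| * |p.1 l|)) P := fun l =>
    ((hDx j).abs.integrable_mul (memLp_two_of_subgaussian (hx l)).abs).const_mul _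
  have i3 : Integrable (fun p : E d × ℝ => |shrink τ p.2 - p.2| * |p.1 j|) P :=
    hDy.abs.integrable_mul (memLp_two_of_subgaussian (hx j)).abs
  have i4 : Integrable (fun p : E d × ℝ => |shrink τ (p.1 j) - p.1 j| * |p.2|) P :=
    (hDx j).abs.integrable_mul (memLp_two_of_subgaussian hy).abs
  have i12 : ∀ l, Integrable (fun p : E d × ℝ =>
      |θ l| * (|shrink τ (p.1 l) - p.1 l| * |p.1 j|) +
      |θ l| * (|shrink τ (p.1 j) - p.1 j| * |p.1 l|)) P := fun l => (i1 l l).add (i2 l)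
  have iF : Integrable (shrinkageGap τ θ j) P :=
    (integrable_finsetSum _ fun l _ => i12 l).add (i3.add i4)
  have ig : Integrable (fun p : E d × ℝ => (inner ℝ θ p.1 - p.2) * p.1 j) P :=
    ((h.memLp_inner θ).sub (memLp_two_of_subgaussian hy)).integrable_mul
      (memLp_two_of_subgaussian (hx j))
  have hpt := abs_clippedGradient_sub_le A hτ h1 h2 θ j
  have hmeas : Measurable fun p : E d × ℝ => clippedGradient A θ p j :=
    (by fun_prop : Measurable fun x : E d => x j).comp (measurable_clippedGradient A θ)
  have ic : Integrable (fun p : E d × ℝ => clippedGradient A θ p j) P := by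
    have : Integrable (fun p : E d × ℝ =>
        clippedGradient A θ p j - (inner ℝ θ p.1 - p.2) * p.1 j) P :=
      iF.mono' (hmeas.aestronglyMeasurable.sub ig.1) (Filter.Eventually.of_forall hpt)
    exact (this.add ig).congr (Filter.Eventually.of_forall fun p => by simp)
  rw [meanGradient, ← h.integral_gradient hc θ j, ← integral_sub ic ig]
  refine (abs_integral_le_integral_abs).trans ?_
  refine (integral_mono (ic.sub ig).abs iF hpt).trans ?_
  have b := fun l m => integral_abs_shrink_sub_mul_le hσ hn (hx l) (hx m)
  have b3 := integral_abs_shrink_sub_mul_le hσ hn hy (hx j)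
  have b4 := integral_abs_shrink_sub_mul_le hσ hn (hx j) hy
  unfold shrinkageGap
  have i34 : Integrable (fun p : E d × ℝ =>
    |shrink τ p.2 - p.2| * |p.1 j| + |shrink τ (p.1 j) - p.1 j| * |p.2|) P := i3.add i4
  rw [integral_add (integrable_finsetSum _ fun l _ => i12 l) i34, integral_add i3 i4,
    integral_finsetSum _ fun l _ => i12 l]
  have hsum : ∑ l, ∫ p : E d × ℝ, |θ l| * (|shrink τ (p.1 l) - p.1 l| * |p.1 j|) +
      |θ l| * (|shrink τ (p.1 j) - p.1 j| * |p.1 l|) ∂P ≤ ∑ l, |θ l| * (10 * σ ^ 2 / n) := by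
    refine Finset.sum_le_sum fun l _ => ?_
    rw [integral_add (i1 l l) (i2 l), integral_const_mul, integral_const_mul, ← mul_add]
    refine mul_le_mul_of_nonneg_left ?_ (abs_nonneg _)
    have := add_le_add (b l j) (b j l)
    refine this.trans (le_of_eq ?_)
    ring
  rw [← Finset.sum_mul] at hsum
  have e5 : (10 * σ ^ 2 / n : ℝ) = 5 * σ ^ 2 / n + 5 * σ ^ 2 / n := by ring
  rw [add_mul, one_mul]
  refine add_le_add hsum ?_
  rw [e5]
  exact add_le_add b3 b4

end

/-! ### The law of the transcript -/

section
variable {n : ℕ} {X Z : Type*} [MeasurableSpace X] [MeasurableSpace Z]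

lemma measurable_snoc {m : ℕ} :
    Measurable fun p : (Fin m → Z) × Z => (Fin.snoc p.1 p.2 : Fin (m + 1) → Z) := by
  refine measurable_pi_lambda _ fun i => ?_
  refine Fin.lastCases ?_ (fun i => ?_) i
  · simpa only [Fin.snoc_last] using measurable_snd
  · simp only [Fin.snoc_castSucc]
    exact (measurable_pi_apply i).comp measurable_fst

instance isMarkovKernel_transcript (M : SeqMechanism n X Z) :
    ∀ (m : ℕ) (h : m ≤ n), IsMarkovKernel (M.transcript m h)
  | 0, _ => by unfold SeqMechanism.transcript; infer_instance
  | m + 1, h => by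
    have := isMarkovKernel_transcript M m (Nat.le_of_succ_le h)
    have := M.markov ⟨m, h⟩
    unfold SeqMechanism.transcript
    exact Kernel.IsMarkovKernel.map _ measurable_snoc

instance (M : SeqMechanism n X Z) (P : Measure X) [IsProbabilityMeasure P] :
    IsProbabilityMeasure (M.transcriptLaw P) := by
  unfold SeqMechanism.transcriptLaw; infer_instance

lemma lintegral_transcript_succ (M : SeqMechanism n X Z) (m : ℕ) (h : m + 1 ≤ n) (x : Fin n → X)
    {f : (Fin (m + 1) → Z) → ℝ≥0∞} (hf : Measurable f) :
    ∫⁻ z, f z ∂M.transcript (m + 1) h x =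
      ∫⁻ z, ∫⁻ w, f (Fin.snoc z w) ∂M.Q ⟨m, h⟩ (x ⟨m, h⟩, z)
        ∂M.transcript m (Nat.le_of_succ_le h) x := by
  have := M.markov ⟨m, h⟩
  rw [SeqMechanism.transcript, Kernel.lintegral_map _ measurable_snoc _ hf,
    Kernel.lintegral_compProd _ _ _ (f := fun p => f (Fin.snoc p.1 p.2))
      (hf.comp measurable_snoc)]
  simp only [Kernel.comap_apply]

/-- The law of the first `m` messages depends only on the data of the first `m` users. -/
lemma transcript_congr (M : SeqMechanism n X Z) (m : ℕ) (h : m ≤ n) {x x' : Fin n → X}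
    (hx : ∀ i : Fin n, (i : ℕ) < m → x i = x' i) : M.transcript m h x = M.transcript m h x' := by
  induction m with
  | zero => simp [SeqMechanism.transcript]
  | succ m ih =>
    refine Measure.ext_of_lintegral _ fun f hf => ?_
    rw [lintegral_transcript_succ M m h x hf, lintegral_transcript_succ M m h x' hf,
      ih (Nat.le_of_succ_le h) fun i hi => hx i (by omega), hx ⟨m, h⟩ (Nat.lt_succ_self m)]

lemma measurable_update_prod (i : Fin n) :
    Measurable fun q : (Fin n → X) × X => Function.update q.1 i q.2 := by
  refine measurable_pi_lambda _ fun j => ?_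
  by_cases hj : j = i
  · subst hj; simpa using measurable_snd
  · simp only [Function.update_of_ne hj]
    exact (measurable_pi_apply j).comp measurable_fst

/-- Resampling one coordinate independently does not change a product law; it suffices to compare
boxes. -/
lemma map_update_pi (P : Measure X) [IsProbabilityMeasure P] (i : Fin n) :
    ((Measure.pi fun _ : Fin n => P).prod P).map (fun q => Function.update q.1 i q.2) =
      Measure.pi fun _ : Fin n => P := by
  have hm := measurable_update_prod (X := X) i
  refine (Measure.pi_eq fun s hs => ?_).symm
  rw [Measure.map_apply hm (MeasurableSet.univ_pi hs)]
  have : (fun q : (Fin n → X) × X => Function.update q.1 i q.2) ⁻¹' Set.univ.pi s =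
      (Set.univ.pi (Function.update s i Set.univ)) ×ˢ s i := by
    ext q
    simp only [Set.mem_preimage, Set.mem_univ_pi, Set.mem_prod]
    constructor
    · intro h
      refine ⟨fun j => ?_, by simpa using h i⟩
      by_cases hj : j = i
      · subst hj; simp
      · simpa [hj] using h j
    · rintro ⟨h1, h2⟩ j
      by_cases hj : j = i
      · subst hj; simpa using h2
      · simpa [hj] using h1 j
  rw [this, Measure.prod_prod, Measure.pi_pi, ← Finset.mul_prod_erase _ _ (Finset.mem_univ i),
    ← Finset.mul_prod_erase _ (fun j => P (s j)) (Finset.mem_univ i)]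
  rw [Function.update_self, measure_univ, one_mul, mul_comm]
  congr 1
  refine Finset.prod_congr rfl fun j hj => ?_
  rw [Function.update_of_ne (Finset.ne_of_mem_erase hj)]

/-- Fubini for a function that depends on entry `i` only through its second argument. -/
lemma lintegral_pi_eval (P : Measure X) [IsProbabilityMeasure P] (i : Fin n)
    {G : (Fin n → X) × X → ℝ≥0∞} (hG : Measurable G)
    (hi : ∀ x a p, G (Function.update x i a, p) = G (x, p)) :
    ∫⁻ x, G (x, x i) ∂(Measure.pi fun _ : Fin n => P) =
      ∫⁻ x, ∫⁻ p, G (x, p) ∂P ∂(Measure.pi fun _ : Fin n => P) := by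
  have hm := measurable_update_prod (X := X) i
  conv_lhs => rw [← map_update_pi P i]
  rw [lintegral_map (f := fun x => G (x, x i))
      (hG.comp (measurable_id.prodMk (measurable_pi_apply i))) hm,
    ← lintegral_prod _ hG.aemeasurable]
  simp [hi]

/-- The messages of i.i.d. users form a chain: the message of user `m` is drawn, given the earlier
messages, from the mixture of its conditional laws. -/
lemma lintegral_transcript_succ_pi (M : SeqMechanism n X Z) (P : Measure X)
    [IsProbabilityMeasure P] (m : ℕ) (h : m + 1 ≤ n)
    {f : (Fin (m + 1) → Z) → ℝ≥0∞} (hf : Measurable f) :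
    ∫⁻ x, ∫⁻ z, f z ∂M.transcript (m + 1) h x ∂(Measure.pi fun _ : Fin n => P) =
      ∫⁻ x, ∫⁻ z, ∫⁻ p, ∫⁻ w, f (Fin.snoc z w) ∂M.Q ⟨m, h⟩ (p, z) ∂P
        ∂M.transcript m (Nat.le_of_succ_le h) x ∂(Measure.pi fun _ : Fin n => P) := by
  have := M.markov ⟨m, h⟩
  have hH : Measurable fun q : X × (Fin m → Z) =>
      ∫⁻ w, f (Fin.snoc q.2 w) ∂M.Q ⟨m, h⟩ q := by
    refine Measurable.lintegral_kernel_prod_right (κ := M.Q ⟨m, h⟩)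
      (f := fun q w => f (Fin.snoc q.2 w)) ?_
    exact hf.comp (measurable_snoc.comp
      ((measurable_snd.comp measurable_fst).prodMk measurable_snd))
  simp only [fun x => lintegral_transcript_succ M m h x hf]
  -- The first `m` messages do not see the datum of user `m`, which may therefore be replaced by an
  -- independent copy.
  rw [lintegral_pi_eval P ⟨m, h⟩ (G := fun q => ∫⁻ z, ∫⁻ w, f (Fin.snoc z w)
    ∂M.Q ⟨m, h⟩ (q.2, z) ∂M.transcript m (Nat.le_of_succ_le h) q.1)]
  · refine lintegral_congr fun x => ?_
    rw [lintegral_lintegral_swap]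
    exact (hH.comp measurable_swap).aemeasurable
  · refine Measurable.lintegral_kernel_prod_right
      (κ := (M.transcript m (Nat.le_of_succ_le h)).comap
        (Prod.fst : (Fin n → X) × X → (Fin n → X)) measurable_fst)
      (f := fun q z => ∫⁻ w, f (Fin.snoc z w) ∂M.Q ⟨m, h⟩ (q.2, z)) ?_
    exact hH.comp ((measurable_snd.comp measurable_fst).prodMk measurable_snd)
  · intro x a p
    dsimp only
    rw [transcript_congr M m (Nat.le_of_succ_le h) (x := Function.update x ⟨m, h⟩ a) (x' := x)]
    intro i hi
    exact Function.update_of_ne (fun hh => by simp [hh] at hi) _ _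

end

/-! ### Concentration of the last group -/

section
variable {d : ℕ} [NeZero d] (A : Params) (P : Measure (E d × ℝ)) [IsProbabilityMeasure P]

lemma measurable_meanGradient (j : Fin d) : Measurable fun θ : E d => meanGradient A P θ j := by
  have h1 : Measurable fun q : E d × (E d × ℝ) => shrinkVec A.τ₁ q.2.1 :=
    (measurable_shrinkVec A.τ₁).comp (measurable_fst.comp measurable_snd)
  have h2 : Measurable fun q : E d × (E d × ℝ) => shrink A.τ₂ q.2.2 :=
    (measurable_shrink A.τ₂).comp (measurable_snd.comp measurable_snd)
  have h3 : Measurable fun q : E d × (E d × ℝ) => clippedGradient A q.1 q.2 :=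
    ((measurable_fst.inner h1).sub h2).smul h1
  have h4 : Measurable fun q : E d × (E d × ℝ) => clippedGradient A q.1 q.2 j :=
    (by fun_prop : Measurable fun x : E d => x j).comp h3
  exact (h4.stronglyMeasurable.integral_prod_right
    (f := fun (θ : E d) (p : E d × ℝ) => clippedGradient A θ p j)).measurable

/-- The compensated exponent of the Chernoff bound for entry `j` of the messages of the last
group. -/
def chernoffExponent (n : ℕ) (s V : ℝ) (j : Fin d) {m : ℕ} (z : Fin m → E d) : ℝ :=
  ∑ i : Fin m, if group n A.T i = A.T - 1 then
    s * z i j - (s * meanGradient A P (iterate A n z (A.T - 1)) j + s ^ 2 * V) else 0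

lemma measurable_chernoffExponent (n : ℕ) (s V : ℝ) (j : Fin d) {m : ℕ} :
    Measurable fun z : Fin m → E d => chernoffExponent A P n s V j z := by
  unfold chernoffExponent
  refine Finset.measurable_sum _ fun i _ => ?_
  have h1 := (measurable_meanGradient A P j).comp (measurable_iterate A (m := m) n (A.T - 1))
  have h2 : Measurable fun z : Fin m → E d => z i j := by fun_prop
  split_ifs
  · exact (h2.const_mul s).sub ((h1.const_mul s).add_const _)
  · exact measurable_const

/-- If user `m` is in the last group, its message leaves iterate `T - 1` unchanged. Otherwise no
earlier user is in the last group, and both exponents are empty sums. -/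
lemma chernoffExponent_snoc (n : ℕ) (s V : ℝ) (j : Fin d) {m : ℕ} (z : Fin m → E d) (w : E d) :
    chernoffExponent A P n s V j (Fin.snoc z w : Fin (m + 1) → E d) =
      chernoffExponent A P n s V j z + if group n A.T m = A.T - 1 then
        s * w j - (s * meanGradient A P (iterate A n z (A.T - 1)) j + s ^ 2 * V) else 0 := by
  by_cases h : group n A.T m = A.T - 1
  · simp [chernoffExponent, Fin.sum_univ_castSucc, iterate_snoc A n (A.T - 1) z w h.ge]
  · have h' : ∀ i : Fin m, ¬ group n A.T i = A.T - 1 := fun i hi => by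
      rw [group_eq_last_iff] at h hi
      omega
    simp [chernoffExponent, Fin.sum_univ_castSucc, h, h']

/-- Averaging the bound `1 + s x_j + s²V` over the datum replaces `x_j` by the mean gradient, and `1
+ t ≤ e^t` shows that the compensator suffices. -/
lemma lintegral_exp_step_le {r s : ℝ} {ε : ℝ} (hε : 0 < ε) {θ : E d}
    (hr : ∀ p, ‖clippedGradient A θ p‖ ≤ r) (hs : |s| * |outputRadius d ε r| ≤ 1) (j : Fin d) :
    ∫⁻ p, ∫⁻ w, ENNReal.ofReal (Real.exp (s * w j -
        (s * meanGradient A P θ j + s ^ 2 * (2 * outputRadius d ε r ^ 2 / d))))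
      ∂randomizerLaw ε r (clippedGradient A θ p) ∂P ≤ 1 := by
  set V := 2 * outputRadius d ε r ^ 2 / d with hV
  set g := meanGradient A P θ j with hg
  have hV0 : 0 ≤ V := by positivity
  have hint : Integrable (fun p => clippedGradient A θ p j) P := by
    refine Integrable.of_bound ((by fun_prop : Measurable fun x : E d => x j).comp
      (measurable_clippedGradient A θ)).aestronglyMeasurable r
      (Filter.Eventually.of_forall fun p => ?_)
    exact (PiLp.norm_apply_le (clippedGradient A θ p) j).trans (hr p)
  -- A negative value would force the integral of a positive function against a probability measure
  -- to be zero.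
  have hnn : ∀ p, 0 ≤ 1 + s * clippedGradient A θ p j + s ^ 2 * V := fun p => by
    have h1 := lintegral_exp_coord_randomizerLaw_le hε (hr p) hs j
    by_contra! hcon
    rw [ENNReal.ofReal_of_nonpos hcon.le, nonpos_iff_eq_zero,
      lintegral_eq_zero_iff (by fun_prop)] at h1
    have h2 : ∀ᵐ _z ∂randomizerLaw ε r (clippedGradient A θ p), False := by
      filter_upwards [h1] with z hz
      simp only [Pi.zero_apply, ENNReal.ofReal_eq_zero] at hz
      exact absurd hz (not_le.2 (Real.exp_pos _))
    simp only [Filter.eventually_false_iff_eq_bot, ae_eq_bot] at h2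
    exact IsProbabilityMeasure.ne_zero _ h2
  calc _ ≤ ∫⁻ p, ENNReal.ofReal (Real.exp (-(s * g + s ^ 2 * V)) *
        (1 + s * clippedGradient A θ p j + s ^ 2 * V)) ∂P := by
        refine lintegral_mono fun p => ?_
        have : ∀ w : E d, ENNReal.ofReal (Real.exp (s * w j - (s * g + s ^ 2 * V))) =
            ENNReal.ofReal (Real.exp (-(s * g + s ^ 2 * V))) *
              ENNReal.ofReal (Real.exp (s * w j)) := fun w => by
          rw [← ENNReal.ofReal_mul (Real.exp_pos _).le, ← Real.exp_add]
          congr 2; ring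
        simp only [this]
        rw [lintegral_const_mul _ (by fun_prop), ENNReal.ofReal_mul (Real.exp_pos _).le]
        exact mul_le_mul_right (lintegral_exp_coord_randomizerLaw_le hε (hr p) hs j) _
    _ = ENNReal.ofReal (∫ p, Real.exp (-(s * g + s ^ 2 * V)) *
        (1 + s * clippedGradient A θ p j + s ^ 2 * V) ∂P) := by
        rw [ofReal_integral_eq_lintegral_ofReal]
        · exact (((integrable_const _).add (hint.const_mul _)).add (integrable_const _)).const_mul _
        · exact Filter.Eventually.of_forall fun p => mul_nonneg (Real.exp_pos _).le (hnn p)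
    _ ≤ 1 := by
        rw [integral_const_mul, integral_add (f := fun p => 1 + s * clippedGradient A θ p j)
            ((integrable_const _).add (hint.const_mul _)) (integrable_const _),
          integral_add (integrable_const _) (hint.const_mul _),
          integral_const_mul]
        simp only [integral_const, probReal_univ, smul_eq_mul, one_mul]
        rw [← meanGradient, ← hg, ← ENNReal.ofReal_one]
        refine ENNReal.ofReal_le_ofReal ?_
        have h1 := Real.add_one_le_exp (s * g + s ^ 2 * V)
        rw [Real.exp_neg, inv_mul_le_iff₀ (Real.exp_pos _)]
        linarith

/-- The exponential is a supermartingale along the messages: the newest message is integrated first,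
at a fixed history, and contributes a factor at most `1`. -/
lemma lintegral_exp_chernoffExponent_le (hε : 0 < A.ε) (h1 : 0 ≤ A.τ₁) (h2 : 0 ≤ A.τ₂)
    (n : ℕ) {s : ℝ} (hs : |s| * |outputRadius d A.ε (radius A d)| ≤ 1) (j : Fin d)
    (m : ℕ) (h : m ≤ n) :
    ∫⁻ x, ∫⁻ z, ENNReal.ofReal (Real.exp (chernoffExponent A P n s
        (2 * outputRadius d A.ε (radius A d) ^ 2 / d) j z))
      ∂(ldpIHT A n d).transcript m h x ∂(Measure.pi fun _ : Fin n => P) ≤ 1 := by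
  induction m with
  | zero => simp [chernoffExponent]
  | succ m ih =>
    rw [lintegral_transcript_succ_pi _ P m h
      (measurable_chernoffExponent A P n s _ j).exp.ennreal_ofReal]
    refine le_trans (lintegral_mono fun x => lintegral_mono fun z => ?_)
      (ih (Nat.le_of_succ_le h))
    simp only [chernoffExponent_snoc, Real.exp_add, ENNReal.ofReal_mul (Real.exp_pos _).le]
    have hm : ∀ c : ℝ, Measurable fun w : E d => ENNReal.ofReal (Real.exp
      (if group n A.T m = A.T - 1 then s * w j - c else 0)) := fun c => by
      split_ifs <;> fun_prop
    simp only [lintegral_const_mul _ (hm _)]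
    rw [lintegral_const_mul']
    · refine mul_le_of_le_one_right' ?_
      by_cases hg : group n A.T m = A.T - 1
      · simp only [hg, if_true]
        have hi := iterate_sparse A n z (A.T - 1)
        have := lintegral_exp_step_le A P hε (θ := iterate A n z (A.T - 1))
          (norm_clippedGradient_le A h1 h2 _ hi.1 hi.2) hs j
        rw [← hg] at this
        rw [← hg]
        exact this
      · have hQ : ∀ p, IsProbabilityMeasure ((ldpIHT A n d).Q ⟨m, h⟩ (p, z)) := fun p =>
          ((ldpIHT A n d).markov ⟨m, h⟩).isProbabilityMeasure _
        simp [hg]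
    · exact ENNReal.ofReal_ne_top

/-- Tail bound for one entry of the compensated sum of the messages of the last group. -/
lemma measure_chernoffExponent_ge_le (hε : 0 < A.ε) (h1 : 0 ≤ A.τ₁) (h2 : 0 ≤ A.τ₂)
    (n : ℕ) {s : ℝ} (hs : |s| * |outputRadius d A.ε (radius A d)| ≤ 1) (j : Fin d) (l : ℝ) :
    (ldpIHT A n d).transcriptLaw P {z | l ≤ chernoffExponent A P n s
        (2 * outputRadius d A.ε (radius A d) ^ 2 / d) j z} ≤ ENNReal.ofReal (Real.exp (-l)) := by
  set f := fun z : Fin n → E d => chernoffExponent A P n s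
        (2 * outputRadius d A.ε (radius A d) ^ 2 / d) j z with hf
  have hm : Measurable fun z => ENNReal.ofReal (Real.exp (f z)) :=
    (measurable_chernoffExponent A P n s _ j).exp.ennreal_ofReal
  have h := lintegral_exp_chernoffExponent_le A P hε h1 h2 n hs j n le_rfl
  rw [← Measure.lintegral_bind (Kernel.aemeasurable _) hm.aemeasurable] at h
  have h3 := mul_meas_ge_le_lintegral (μ := (ldpIHT A n d).transcriptLaw P) hm
    (ENNReal.ofReal (Real.exp l))
  have h4 : {z | ENNReal.ofReal (Real.exp l) ≤ ENNReal.ofReal (Real.exp (f z))} =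
      {z | l ≤ f z} := by
    ext z
    simp [ENNReal.ofReal_le_ofReal_iff (Real.exp_pos _).le]
  rw [h4] at h3
  have h5 := h3.trans h
  rw [Real.exp_neg, ENNReal.ofReal_inv_of_pos (Real.exp_pos _)]
  rwa [ENNReal.le_inv_iff_mul_le, mul_comm]

lemma chernoffExponent_eq {n : ℕ} (hN : 0 < (groupSize n A.T (A.T - 1) : ℝ)) (s V : ℝ) (j : Fin d)
    (z : Fin n → E d) :
    chernoffExponent A P n s V j z = groupSize n A.T (A.T - 1) *
      (s * (groupMean n A.T (A.T - 1) z j -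
        meanGradient A P (iterate A n z (A.T - 1)) j) - s ^ 2 * V) := by
  set c := s * meanGradient A P (iterate A n z (A.T - 1)) j + s ^ 2 * V with hc
  have e1 : chernoffExponent A P n s V j z =
      s * (∑ i : Fin n, if group n A.T i = A.T - 1 then z i j else 0) -
        groupSize n A.T (A.T - 1) * c := by
    rw [chernoffExponent, Finset.mul_sum, groupSize, Finset.card_filter]
    push_cast
    rw [Finset.sum_mul, ← Finset.sum_sub_distrib]
    refine Finset.sum_congr rfl fun i _ => ?_
    split_ifs <;> simp [hc]
  have e2 : groupMean n A.T (A.T - 1) z j = (groupSize n A.T (A.T - 1) : ℝ)⁻¹ *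
      ∑ i : Fin n, if group n A.T i = A.T - 1 then z i j else 0 := by
    simp only [groupMean, PiLp.smul_apply, smul_eq_mul, WithLp.ofLp_sum, Finset.sum_apply]
    congr 1
    refine Finset.sum_congr rfl fun i _ => ?_
    split_ifs <;> simp
  rw [e1, e2, hc]
  field_simp
  ring

/-- With high probability, the average message of the last group is entrywise close to the mean
gradient at the last but one iterate. -/
lemma measure_groupMean_le (hε : 0 < A.ε) (h1 : 0 ≤ A.τ₁) (h2 : 0 ≤ A.τ₂)
    {n : ℕ} (hN : 0 < (groupSize n A.T (A.T - 1) : ℝ)) {s : ℝ} (hs0 : 0 < s)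
    (hs : s * |outputRadius d A.ε (radius A d)| ≤ 1) (l : ℝ) :
    (ldpIHT A n d).transcriptLaw P {z | ¬ ∀ j, |groupMean n A.T (A.T - 1) z j -
        meanGradient A P (iterate A n z (A.T - 1)) j| ≤
        s * (2 * outputRadius d A.ε (radius A d) ^ 2 / d) +
          l / (s * groupSize n A.T (A.T - 1))} ≤
      ENNReal.ofReal (2 * d * Real.exp (-l)) := by
  set V := 2 * outputRadius d A.ε (radius A d) ^ 2 / d with hV
  set N : ℝ := (groupSize n A.T (A.T - 1) : ℝ) with hNd
  set μ := (ldpIHT A n d).transcriptLaw P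
  have hs1 : |s| * |outputRadius d A.ε (radius A d)| ≤ 1 := by rwa [abs_of_pos hs0]
  have hs2 : |-s| * |outputRadius d A.ε (radius A d)| ≤ 1 := by rwa [abs_neg]
  -- Both signs of the Chernoff parameter are needed for a two-sided bound, which makes `2d` events
  -- in all.
  have hsub : {z : Fin n → E d | ¬ ∀ j, |groupMean n A.T (A.T - 1) z j -
        meanGradient A P (iterate A n z (A.T - 1)) j| ≤ s * V + l / (s * N)} ⊆
      ⋃ j : Fin d, ({z | l ≤ chernoffExponent A P n s V j z} ∪
        {z | l ≤ chernoffExponent A P n (-s) V j z}) := by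
    intro z hz
    simp only [Set.mem_ofPred_eq, not_forall, not_le] at hz
    obtain ⟨j, hj⟩ := hz
    simp only [Set.mem_iUnion, Set.mem_union, Set.mem_ofPred_eq]
    refine ⟨j, ?_⟩
    rw [chernoffExponent_eq A P hN, chernoffExponent_eq A P hN, ← hNd]
    set D := groupMean n A.T (A.T - 1) z j - meanGradient A P (iterate A n z (A.T - 1)) j
    have hsN : 0 < s * N := by positivity
    have key : ∀ a : ℝ, s * V + l / (s * N) < a → l ≤ N * (s * a - s ^ 2 * V) := fun a ha => by
      have e : l = s * N * (l / (s * N)) := by field_simp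
      have h3 : s * N * (l / (s * N)) ≤ s * N * (a - s * V) :=
        mul_le_mul_of_nonneg_left (by linarith) hsN.le
      rw [e]
      refine h3.trans (le_of_eq ?_)
      ring
    rcases abs_cases D with ⟨h, -⟩ | ⟨h, -⟩
    · rw [h] at hj; exact Or.inl (key D hj)
    · rw [h] at hj
      refine Or.inr ?_
      have := key _ hj
      rw [neg_sq, neg_mul, ← mul_neg]
      exact this
  refine (measure_mono hsub).trans ((measure_iUnion_fintype_le _ _).trans ?_)
  calc _ ≤ ∑ _j : Fin d, (ENNReal.ofReal (Real.exp (-l)) + ENNReal.ofReal (Real.exp (-l))) :=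
        Finset.sum_le_sum fun j _ => (measure_union_le _ _).trans (add_le_add
          (measure_chernoffExponent_ge_le A P hε h1 h2 n hs1 j l)
          (measure_chernoffExponent_ge_le A P hε h1 h2 n hs2 j l))
    _ = ENNReal.ofReal (2 * d * Real.exp (-l)) := by
        rw [Finset.sum_const, Finset.card_univ, Fintype.card_fin, nsmul_eq_mul,
          ← ENNReal.ofReal_add (Real.exp_pos _).le (Real.exp_pos _).le,
          ← ENNReal.ofReal_natCast, ← ENNReal.ofReal_mul (Nat.cast_nonneg _)]
        congr 1; ring

end

/-! ### Utility -/

section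
variable {d k : ℕ} {P : Measure (E d × ℝ)} [IsProbabilityMeasure P] {θs : E d} {σ : ℝ≥0}

/-- The output is close to the parameter if the average message of the last group is close to its
mean. -/
lemma IsSparseModel.norm_iterate_sub_le (h : IsSparseModel P θs k σ) (hc : covX P = 1)
    (hσ : 0 < σ) (A : Params) {n : ℕ} (hn : 2 ≤ n) (hT : 1 ≤ A.T) (hη : A.η = 1)
    (h1 : A.τ₁ = 2 * σ * Real.sqrt (Real.log n)) (h2 : A.τ₂ = 2 * σ * Real.sqrt (Real.log n))
    (hk : A.k' = 8 * k) (z : Fin n → E d) {δ : ℝ} (hδ : 0 ≤ δ)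
    (hz : ∀ j, |groupMean n A.T (A.T - 1) z j -
      meanGradient A P (iterate A n z (A.T - 1)) j| ≤ δ) :
    ‖iterate A n z A.T - θs‖ ≤
      Real.sqrt (9 * k) * (2 * (δ + (Real.sqrt (8 * k) + 1) * (10 * σ ^ 2 / n))) := by
  obtain ⟨t, ht⟩ : ∃ t, A.T = t + 1 := ⟨A.T - 1, by omega⟩
  have ht' : A.T - 1 = t := by omega
  rw [ht'] at hz
  have e : iterate A n z A.T =
      projBall (trunc A.k' (iterate A n z t - A.η • groupMean n A.T t z)) := by
    conv_lhs => rw [ht]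
    rfl
  rw [e]
  refine (norm_projBall_sub_le _ _ (norm_le_one_of_l1 θs h.l1_le)).trans ?_
  have hi := iterate_sparse A n z t
  have hl1 := sum_abs_le_of_sparse _ hi.1 hi.2
  have hk' : (A.k' : ℝ) = 8 * k := by rw [hk]; push_cast; ring
  rw [hk'] at hl1
  have hb : ∀ j, |(iterate A n z t - A.η • groupMean n A.T t z) j - θs j| ≤
      δ + (Real.sqrt (8 * k) + 1) * (10 * σ ^ 2 / n) := fun j => by
    have b1 := hz j
    have b2 := h.abs_meanGradient_sub_le hc hσ A hn h1 h2 (iterate A n z t) j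
    have b3 : (∑ l, |iterate A n z t l| + 1) * (10 * (σ : ℝ) ^ 2 / n) ≤
        (Real.sqrt (8 * k) + 1) * (10 * σ ^ 2 / n) := by gcongr
    -- With `η = 1` the current iterate cancels, leaving minus the fluctuation of the messages minus
    -- the shrinkage bias.
    have e2 : (iterate A n z t - A.η • groupMean n A.T t z) j - θs j =
        -(groupMean n A.T t z j - meanGradient A P (iterate A n z t) j) -
        (meanGradient A P (iterate A n z t) j - (iterate A n z t j - θs j)) := by
      simp only [hη, PiLp.sub_apply, one_smul]
      ring
    rw [e2]
    refine (abs_sub _ _).trans ?_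
    rw [abs_neg]
    linarith
  have hmain := norm_trunc_sub_le (s := A.k') (by omega) _ θs (by positivity) h.sparse hb
  have e3 : (A.k' : ℝ) + k = 9 * k := by rw [hk']; ring
  rwa [e3] at hmain

end

/-! ### Numerical estimates and the final probability bound -/

section
variable {n d k : ℕ} [NeZero d] {P : Measure (E d × ℝ)} [IsProbabilityMeasure P] {θs : E d}
  {σ : ℝ≥0}

lemma iterate_eq_of_sparsity_zero (A : Params) {m : ℕ} (hk : A.k' = 0) (z : Fin m → E d) (t : ℕ) :
    iterate A n z t = 0 := by
  have := (iterate_sparse A n z t).1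
  rw [hk, Nat.le_zero, Finset.card_eq_zero, Finset.filter_eq_empty_iff] at this
  ext j
  simpa using this (Finset.mem_univ j)

lemma norm_iterate_sub_le_two (A : Params) {m : ℕ} (hθ : ‖θs‖ ≤ 1) (z : Fin m → E d) (t : ℕ) :
    ‖iterate A n z t - θs‖ ≤ 2 := by
  have h1 := (iterate_sparse A n z t).2
  have h2 := norm_sub_le (iterate A n z t) θs
  linarith

lemma half_le_log (hn : 2 ≤ n) : 1 / 2 ≤ Real.log n := by
  have := Real.log_le_log (by norm_num) (by exact_mod_cast hn : (2 : ℝ) ≤ n)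
  linarith [Real.log_two_gt_d9]

lemma log_le_log_mul (hn : 2 ≤ n) : Real.log n ≤ Real.log (n * d) := by
  have hd : (1 : ℝ) ≤ d := by exact_mod_cast Nat.one_le_iff_ne_zero.2 (NeZero.ne d)
  have hn' : (2 : ℝ) ≤ n := by exact_mod_cast hn
  exact Real.log_le_log (by linarith) (by nlinarith)

/-- In this regime the claim is trivial. The constant is `16 = 2 · 2³`, since the logarithm is only
known to be at least `1/2`. -/
lemma two_le_bound_of_le (hn : 2 ≤ n) (hk : 1 ≤ k) (hnd : n ≤ d) {ε ε₀ C : ℝ} (hε : 0 < ε)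
    (hε₀ : ε ≤ ε₀) (hC : 16 * ε₀ ≤ C) :
    2 ≤ C * (k * Real.sqrt d / (Real.sqrt n * ε)) * Real.log (n * d) ^ 3 := by
  have hL : 1 / 2 ≤ Real.log (n * d) := (half_le_log hn).trans (log_le_log_mul hn)
  have hn0 : (0 : ℝ) < n := by exact_mod_cast (by omega : 0 < n)
  have hsn : 0 < Real.sqrt n := Real.sqrt_pos.2 hn0
  have hsd : Real.sqrt n ≤ Real.sqrt d := Real.sqrt_le_sqrt (by exact_mod_cast hnd)
  have hk' : (1 : ℝ) ≤ k := by exact_mod_cast hk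
  have h1 : 1 / ε₀ ≤ k * Real.sqrt d / (Real.sqrt n * ε) := by
    rw [div_le_div_iff₀ (by linarith) (by positivity)]
    have : Real.sqrt n * ε ≤ Real.sqrt d * ε₀ := by gcongr
    nlinarith [mul_nonneg (Real.sqrt_nonneg d) (hε.le.trans hε₀)]
  have h2 : (1 / 2 : ℝ) ^ 3 ≤ Real.log (n * d) ^ 3 := by gcongr
  have h0 : 0 < ε₀ := hε.trans_le hε₀
  have hC0 : 0 ≤ C := le_trans (by positivity) hC
  calc (2 : ℝ) = 16 * ε₀ * (1 / ε₀) * (1 / 2) ^ 3 := by field_simp; norm_num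
    _ ≤ _ := by gcongr

/-- The numerical bound on the entrywise error of the last gradient step. -/
lemma entry_error_le (hn : 2 ≤ n) {ε ε₀ T N R r K : ℝ} (hε : 0 < ε)
    (hε₀ : ε ≤ ε₀) (hT0 : 0 < T) (hT : T ≤ Real.log n + 1) (hN : n / T ≤ N)
    (hr : r = Real.sqrt d * (2 * σ * Real.sqrt (Real.log n)) * (Real.sqrt (8 * k) *
      (2 * σ * Real.sqrt (Real.log n)) + 2 * σ * Real.sqrt (Real.log n)))
    (hR0 : 0 < R) (hK : 0 ≤ K) (hR : R ≤ r * (K / ε) * (2 * Real.sqrt d)) :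
    (Real.sqrt (d / n) / R) * (2 * R ^ 2 / d) +
        (2 * Real.log (n * d)) / ((Real.sqrt (d / n) / R) * N) +
        (Real.sqrt (8 * k) + 1) * (10 * σ ^ 2 / n) ≤
      σ ^ 2 * (112 * K + 80 * ε₀) * (Real.sqrt (8 * k) + 1) *
        (Real.sqrt d / (Real.sqrt n * ε)) * Real.log (n * d) ^ 3 := by
  have hl := half_le_log hn
  have hlL := log_le_log_mul (d := d) hn
  set l := Real.log n with hld
  set L := Real.log (n * d) with hLd
  have hn2 : (2 : ℝ) ≤ n := by exact_mod_cast hn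
  have hn0 : (0 : ℝ) < n := by linarith
  have hd1 : (1 : ℝ) ≤ d := by exact_mod_cast Nat.one_le_iff_ne_zero.2 (NeZero.ne d)
  have hd0 : (0 : ℝ) < d := by linarith
  have hsl : Real.sqrt l * Real.sqrt l = l := Real.mul_self_sqrt (by linarith)
  have hσ0 : (0 : ℝ) ≤ σ := σ.2
  set u := Real.sqrt d with hu
  set v := Real.sqrt n with hv
  set w := Real.sqrt (8 * k) + 1 with hw
  have hw0 : 0 < w := by positivity
  have hu0 : 0 < u := Real.sqrt_pos.2 hd0
  have hv0 : 0 < v := Real.sqrt_pos.2 hn0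
  have hu1 : 1 ≤ u := by rw [hu, Real.one_le_sqrt]; exact hd1
  have huu : u ^ 2 = d := Real.sq_sqrt hd0.le
  have hvv : v ^ 2 = n := Real.sq_sqrt hn0.le
  have hv1 : 1 ≤ v := by rw [hv, Real.one_le_sqrt]; linarith
  have hr' : r = u * (4 * σ ^ 2 * l) * w := by
    rw [hr, hw]; linear_combination u * 4 * σ ^ 2 * (Real.sqrt (8 * k) + 1) * hsl
  have hsq : Real.sqrt (d / n) = u / v := Real.sqrt_div hd0.le _
  have hRR : R / (u * v) ≤ 8 * K * σ ^ 2 * l * w * (u / (v * ε)) := by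
    rw [div_le_iff₀ (by positivity)]
    refine hR.trans (le_of_eq ?_)
    rw [hr']; field_simp; ring
  have hT3 : T ≤ 3 * l := by linarith
  have hN' : (n : ℝ) / (3 * l) ≤ N := le_trans (by gcongr) hN
  have hNpos : 0 < (n : ℝ) / (3 * l) := by positivity
  -- With `s = √(d/n)/R`, the variance term and the tail term are both of order `R / √(dn)` up to
  -- logarithms.
  have t1 : (Real.sqrt (d / n) / R) * (2 * R ^ 2 / d) = 2 * (R / (u * v)) := by
    rw [hsq, ← huu]; field_simp
  have t2 : (2 * L) / ((Real.sqrt (d / n) / R) * N) ≤ 6 * L * l * (R / (u * v)) := by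
    calc _ ≤ (2 * L) / ((Real.sqrt (d / n) / R) * (n / (3 * l))) := by
          have : 0 ≤ L := by linarith
          have : 0 < Real.sqrt (d / n) := by rw [hsq]; positivity
          gcongr
      _ = _ := by rw [hsq, ← hvv]; field_simp; ring
  have hQ : 0 < u / (v * ε) := by positivity
  have hl0 : 0 < l := by linarith
  have hL0 : 0 < L := by linarith
  have c1 : (2 + 6 * L * l) * l ≤ 14 * L ^ 3 := by
    have a1 : 2 ≤ 8 * L ^ 2 := by
      have : (1 / 2 : ℝ) ^ 2 ≤ L ^ 2 := by gcongr; linarith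
      linarith
    have a2 : 6 * L * l ≤ 6 * L * L := by gcongr
    calc (2 + 6 * L * l) * l ≤ (8 * L ^ 2 + 6 * L * L) * L := by gcongr
      _ = 14 * L ^ 3 := by ring
  have c2 : 1 ≤ 8 * L ^ 3 := by
    have : (1 / 2 : ℝ) ^ 3 ≤ L ^ 3 := by gcongr; linarith
    linarith
  have p1 : 2 * (R / (u * v)) + 6 * L * l * (R / (u * v)) ≤
      σ ^ 2 * (112 * K) * w * (u / (v * ε)) * L ^ 3 := by
    calc 2 * (R / (u * v)) + 6 * L * l * (R / (u * v))
        = (2 + 6 * L * l) * (R / (u * v)) := by ring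
      _ ≤ (2 + 6 * L * l) * (8 * K * σ ^ 2 * l * w * (u / (v * ε))) := by gcongr
      _ = ((2 + 6 * L * l) * l) * (8 * K * σ ^ 2 * w * (u / (v * ε))) := by ring
      _ ≤ (14 * L ^ 3) * (8 * K * σ ^ 2 * w * (u / (v * ε))) := by gcongr
      _ = _ := by ring
  -- The bias of order `1/n` is absorbed into the main rate, using `ε ≤ ε₀` and `n, d ≥ 1`.
  have q1 : 1 / (n : ℝ) ≤ ε₀ * (u / (v * ε)) := by
    rw [← hvv, mul_div_assoc', div_le_div_iff₀ (by positivity) (by positivity)]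
    have hε₀0 : 0 < ε₀ := hε.trans_le hε₀
    calc 1 * (v * ε) = ε * 1 * v := by ring
      _ ≤ ε₀ * u * v := by gcongr
      _ ≤ ε₀ * u * v ^ 2 := by
        have : v ≤ v ^ 2 := le_self_pow₀ hv1 two_ne_zero
        gcongr
  have hε₀0 : 0 < ε₀ := hε.trans_le hε₀
  have p2 : w * (10 * σ ^ 2 / n) ≤ σ ^ 2 * (80 * ε₀) * w * (u / (v * ε)) * L ^ 3 := by
    calc w * (10 * σ ^ 2 / n) = 10 * σ ^ 2 * w * (1 / n) * 1 := by ring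
      _ ≤ 10 * σ ^ 2 * w * (ε₀ * (u / (v * ε))) * (8 * L ^ 3) := by gcongr
      _ = _ := by ring
  rw [t1]
  calc _ ≤ 2 * (R / (u * v)) + 6 * L * l * (R / (u * v)) + w * (10 * σ ^ 2 / n) := by gcongr
    _ ≤ _ := add_le_add p1 p2
    _ = _ := by ring

/-- Integrality of `k` gives `√k ≤ k`; the two factors of order `√k`, from thresholding and from the
radius, combine to `k`. -/
lemma sqrt_mul_sqrt_add_one_le (k : ℕ) :
    Real.sqrt (9 * k) * (Real.sqrt (8 * k) + 1) ≤ 12 * k := by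
  have h1 : Real.sqrt (8 * k) ≤ Real.sqrt (9 * k) := Real.sqrt_le_sqrt (by
    have : (0 : ℝ) ≤ k := k.cast_nonneg
    linarith)
  have h2 : Real.sqrt (9 * k) * Real.sqrt (9 * k) = 9 * k := Real.mul_self_sqrt (by positivity)
  have h3 : Real.sqrt (9 * k) ≤ 3 * k := by
    refine Real.sqrt_le_iff.2 ⟨by positivity, ?_⟩
    have : (k : ℝ) ≤ k ^ 2 := by exact_mod_cast Nat.le_self_pow two_ne_zero k
    nlinarith
  nlinarith [Real.sqrt_nonneg (9 * (k : ℝ))]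

lemma outputLaw_apply (A : Params) {S : Set (E d)} (hS : MeasurableSet S) :
    outputLaw A n d P S = (ldpIHT A n d).transcriptLaw P {z | iterate A n z A.T ∈ S} :=
  Measure.map_apply (measurable_iterate A n A.T) hS

/-- The utility guarantee. -/
lemma IsSparseModel.le_outputLaw (h : IsSparseModel P θs k σ) (hc : covX P = 1) (hn : 2 ≤ n)
    {ε ε₀ C : ℝ} (hε : 0 < ε) (hε₀ : ε ≤ ε₀)
    (hC : C = 2 + 16 * ε₀ + 24 * (σ ^ 2 * (112 * (Real.exp ε₀ + 1) + 80 * ε₀))) :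
    ENNReal.ofReal (1 - C * (d : ℝ) ^ (-1 : ℝ)) ≤
      outputLaw
        { T := ⌈1 * Real.log n⌉₊
          ε := ε
          η := 1
          τ₁ := 2 * σ * Real.sqrt (Real.log n)
          τ₂ := 2 * σ * Real.sqrt (Real.log n)
          k' := 8 * k } n d P
        {θT | ‖θT - θs‖ ≤ C * (k * Real.sqrt d / (Real.sqrt n * ε)) *
          Real.log (n * d) ^ 3} := by
  set A : Params :=
    { T := ⌈1 * Real.log n⌉₊
      ε := ε
      η := 1
      τ₁ := 2 * σ * Real.sqrt (Real.log n)
      τ₂ := 2 * σ * Real.sqrt (Real.log n)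
      k' := 8 * k } with hA
  set B := C * (k * Real.sqrt d / (Real.sqrt n * ε)) * Real.log (n * d) ^ 3 with hB
  have hε₀0 : 0 < ε₀ := hε.trans_le hε₀
  have hexp := Real.exp_pos ε₀
  have hC0 : 0 < C := by rw [hC]; positivity
  have hS : MeasurableSet {θT : E d | ‖θT - θs‖ ≤ B} :=
    measurableSet_le (by fun_prop) measurable_const
  have hl := half_le_log hn
  have hL : 1 / 2 ≤ Real.log (n * d) := hl.trans (log_le_log_mul hn)
  have hd1 : (1 : ℝ) ≤ d := by exact_mod_cast Nat.one_le_iff_ne_zero.2 (NeZero.ne d)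
  have hn2 : (2 : ℝ) ≤ n := by exact_mod_cast hn
  have hpow : (d : ℝ) ^ (-1 : ℝ) = (d : ℝ)⁻¹ := Real.rpow_neg_one _
  rw [outputLaw_apply A hS, hpow]
  -- Covers the degenerate cases `k = 0` and `n ≤ d`, where the bound holds for every transcript.
  have hsure : (∀ z : Fin n → E d, ‖iterate A n z A.T - θs‖ ≤ B) →
      ENNReal.ofReal (1 - C * (d : ℝ)⁻¹) ≤ (ldpIHT A n d).transcriptLaw P
        {z | iterate A n z A.T ∈ {θT : E d | ‖θT - θs‖ ≤ B}} := fun hz => by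
    have : {z : Fin n → E d | iterate A n z A.T ∈ {θT : E d | ‖θT - θs‖ ≤ B}} = Set.univ :=
      Set.eq_univ_of_forall hz
    rw [this, measure_univ]
    refine ENNReal.ofReal_le_one.2 ?_
    have : 0 ≤ C * (d : ℝ)⁻¹ := by positivity
    linarith
  rcases Nat.eq_zero_or_pos k with hk | hk
  · refine hsure fun z => ?_
    have h1 := h.sparse
    rw [hk, Nat.le_zero, Finset.card_eq_zero, Finset.filter_eq_empty_iff] at h1
    have h2 : θs = 0 := by
      ext j
      simpa using h1 (Finset.mem_univ j)
    rw [iterate_eq_of_sparsity_zero A (by simp [hA, hk]), h2, hB, hk]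
    simp
  rcases le_total n d with hnd | hnd
  · refine hsure fun z => ?_
    refine (norm_iterate_sub_le_two A (norm_le_one_of_l1 θs h.l1_le) z A.T).trans ?_
    refine two_le_bound_of_le hn hk hnd hε hε₀ ?_
    rw [hC]
    have : 0 ≤ 24 * ((σ : ℝ) ^ 2 * (112 * (Real.exp ε₀ + 1) + 80 * ε₀)) := by positivity
    linarith
  have hσ := h.varianceProxy_pos hc
  have hσ' : (0 : ℝ) < σ := hσ
  have hsl : 0 < Real.sqrt (Real.log n) := Real.sqrt_pos.2 (by linarith)
  have hT : 1 ≤ A.T := Nat.one_le_ceil_iff.2 (by linarith)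
  have hT' : (A.T : ℝ) ≤ Real.log n + 1 := by
    have := Nat.ceil_lt_add_one (a := 1 * Real.log n) (by linarith)
    simp only [hA]
    linarith
  have hT0 : (0 : ℝ) < A.T := by exact_mod_cast hT
  have hNT := le_groupSize_last (n := n) hT
  have hN : 0 < (groupSize n A.T (A.T - 1) : ℝ) := lt_of_lt_of_le (by positivity) hNT
  have hτ : 0 ≤ 2 * σ * Real.sqrt (Real.log n) := by positivity
  have hr : radius A d = Real.sqrt d * (2 * σ * Real.sqrt (Real.log n)) * (Real.sqrt (8 * k) *
      (2 * σ * Real.sqrt (Real.log n)) + 2 * σ * Real.sqrt (Real.log n)) := by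
    simp [radius, hA]
  have hr0 : 0 < radius A d := by
    have : 0 < Real.sqrt d := Real.sqrt_pos.2 (by linarith)
    rw [hr]; positivity
  have hR0 : 0 < outputRadius d A.ε (radius A d) := outputRadius_pos hε hr0
  have hR := outputRadius_le (d := d) hε hε₀ hr0.le
  have herr := entry_error_le (σ := σ) (k := k) (d := d) hn hε hε₀ hT0 hT' hNT hr hR0
    (K := Real.exp ε₀ + 1) (by positivity) hR
  set R := outputRadius d A.ε (radius A d) with hRd
  have hs0 : 0 < Real.sqrt (d / n) / R := div_pos (Real.sqrt_pos.2 (by positivity)) hR0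
  -- Admissibility in the Bernstein bound amounts to `√(d/n) ≤ 1`; this is where `d ≤ n` is used.
  have hs : Real.sqrt (d / n) / R * |R| ≤ 1 := by
    rw [abs_of_pos hR0, div_mul_cancel₀ _ hR0.ne', Real.sqrt_le_one]
    exact div_le_one_of_le₀ (by exact_mod_cast hnd) (by positivity)
  -- At the level `2 log(nd)` the failure probability is `2d / (nd)² = (2/n²) d⁻¹`, which gives the
  -- exponent `c = 1`.
  have htail := measure_groupMean_le A P hε hτ hτ hN hs0 hs (2 * Real.log (n * d))
  set δ := Real.sqrt (d / n) / R * (2 * R ^ 2 / d) +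
    2 * Real.log (n * d) / (Real.sqrt (d / n) / R * groupSize n A.T (A.T - 1)) with hδ
  have hδ0 : 0 ≤ δ := by
    have : 0 ≤ Real.log (n * d) := by linarith
    positivity
  set μ := (ldpIHT A n d).transcriptLaw P
  set Bad := {z : Fin n → E d | ¬ ∀ j, |groupMean n A.T (A.T - 1) z j -
        meanGradient A P (iterate A n z (A.T - 1)) j| ≤ δ} with hBad
  have hgood : Badᶜ ⊆ {z | iterate A n z A.T ∈ {θT : E d | ‖θT - θs‖ ≤ B}} := by
    intro z hz
    have hz' : ∀ j, |groupMean n A.T (A.T - 1) z j -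
        meanGradient A P (iterate A n z (A.T - 1)) j| ≤ δ := by
      by_contra hcon; exact hz hcon
    have h1 := h.norm_iterate_sub_le hc hσ A hn hT rfl rfl rfl rfl z hδ0 hz'
    have h2 := sqrt_mul_sqrt_add_one_le k
    refine h1.trans ?_
    have hQ : 0 ≤ Real.sqrt d / (Real.sqrt n * ε) * Real.log (n * d) ^ 3 := by positivity
    set D := (σ : ℝ) ^ 2 * (112 * (Real.exp ε₀ + 1) + 80 * ε₀) with hD
    have hD0 : 0 ≤ D := by positivity
    calc _ ≤ Real.sqrt (9 * k) * (2 * (D * (Real.sqrt (8 * k) + 1) *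
          (Real.sqrt d / (Real.sqrt n * ε)) * Real.log (n * d) ^ 3)) := by gcongr
      _ = 2 * D * (Real.sqrt (9 * k) * (Real.sqrt (8 * k) + 1)) *
          (Real.sqrt d / (Real.sqrt n * ε) * Real.log (n * d) ^ 3) := by ring
      _ ≤ 2 * D * (12 * k) *
          (Real.sqrt d / (Real.sqrt n * ε) * Real.log (n * d) ^ 3) := by gcongr
      _ = 24 * D * (k * (Real.sqrt d / (Real.sqrt n * ε) * Real.log (n * d) ^ 3)) := by ring
      _ ≤ C * (k * (Real.sqrt d / (Real.sqrt n * ε) * Real.log (n * d) ^ 3)) := by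
          gcongr
          linarith
      _ = B := by rw [hB]; ring
  have hprob : 2 * d * Real.exp (-(2 * Real.log (n * d))) ≤ C * (d : ℝ)⁻¹ := by
    have e : Real.exp (-(2 * Real.log (n * d))) = ((n * d : ℝ) ^ 2)⁻¹ := by
      rw [Real.exp_neg, two_mul, Real.exp_add, Real.exp_log (by positivity), sq]
    have e2 : 2 * d * ((n * d : ℝ) ^ 2)⁻¹ = 2 / (n : ℝ) ^ 2 * (d : ℝ)⁻¹ := by
      field_simp
    rw [e, e2]
    have h1 : 2 / (n : ℝ) ^ 2 ≤ C := by
      rw [div_le_iff₀ (by positivity)]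
      have : 2 ≤ C := by
        rw [hC]
        have : 0 ≤ 24 * ((σ : ℝ) ^ 2 * (112 * (Real.exp ε₀ + 1) + 80 * ε₀)) := by positivity
        linarith
      nlinarith
    gcongr
  have hone : 1 ≤ μ {z | iterate A n z A.T ∈ {θT : E d | ‖θT - θs‖ ≤ B}} +
      ENNReal.ofReal (C * (d : ℝ)⁻¹) := by
    calc 1 = μ (Badᶜ ∪ Bad) := by rw [Set.compl_union_self, measure_univ]
      _ ≤ μ Badᶜ + μ Bad := measure_union_le _ _
      _ ≤ _ := add_le_add (measure_mono hgood)
          (htail.trans (ENNReal.ofReal_le_ofReal hprob))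
  rw [ENNReal.ofReal_sub _ (by positivity), ENNReal.ofReal_one]
  exact tsub_le_iff_right.2 hone

end

end

end SparseLDP

theorem mainTheorem4 :
    -- privacy, for all parameters; the vectors handed to the randomizer lie in its domain
    (∀ (A : SparseLDP.Params) (n d : ℕ) [NeZero d], 0 < A.ε → 0 ≤ A.τ₁ → 0 ≤ A.τ₂ →
      (SparseLDP.ldpIHT A n d).IsLDP A.ε ∧
      ∀ (i : Fin n) (p : (SparseLDP.E d × ℝ) × (Fin i → SparseLDP.E d)),
        ‖SparseLDP.userGradient A n i p‖ ≤ SparseLDP.radius A d) ∧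
    -- utility
    ∃ (a η b c : ℝ) (q : ℕ), 0 < a ∧ 0 < η ∧ 0 < b ∧ 0 < c ∧
      ∀ (σ : ℝ≥0) (ε₀ : ℝ), 0 < ε₀ → ∃ C : ℝ, 0 < C ∧
        ∀ (n d k : ℕ) [NeZero d] (ε : ℝ), 2 ≤ n → 0 < ε → ε ≤ ε₀ →
        ∀ (P : Measure (SparseLDP.E d × ℝ)) [IsProbabilityMeasure P] (θ : SparseLDP.E d),
          SparseLDP.IsSparseModel P θ k σ → SparseLDP.covX P = 1 →
          ENNReal.ofReal (1 - C * (d : ℝ) ^ (-c)) ≤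
            SparseLDP.outputLaw
              { T := ⌈a * Real.log n⌉₊
                ε := ε
                η := η
                τ₁ := b * σ * Real.sqrt (Real.log n)
                τ₂ := b * σ * Real.sqrt (Real.log n)
                k' := 8 * k } n d P
              {θT | ‖θT - θ‖ ≤ C * (k * Real.sqrt d / (Real.sqrt n * ε)) *
                Real.log (n * d) ^ q} := by
  -- The witnesses are `a = 1`, `η = 1`, `b = 2`, `c = 1` and `q = 3`. In `C`, the part `16 ε₀`
  -- serves the case `n ≤ d`, the last summand serves the main case, and the `2` serves the failure
  -- probability.
  refine ⟨fun A n d _ hε h1 h2 => ⟨SparseLDP.ldpIHT_isLDP A n hε.le, fun i p =>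
    SparseLDP.norm_userGradient_le A h1 h2 n i p⟩, 1, 1, 2, 1, 3, one_pos, one_pos, two_pos,
    one_pos, fun σ ε₀ hε₀ => ⟨2 + 16 * ε₀ +
      24 * (σ ^ 2 * (112 * (Real.exp ε₀ + 1) + 80 * ε₀)), ?_, ?_⟩⟩
  · have := Real.exp_pos ε₀
    positivity
  · intro n d k _ ε hn hε hle P _ θ h hc
    exact h.le_outputLaw hc hn hε hle rfl
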